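/- Let $K$ be an algebraically closed field of characteristic zero, let $d\in\mathbb N$, and let $\lambda=(1^{e_1}2^{e_2}\cdots d^{e_d})$ be a partition of $d$, where $e_r$ is the number of parts equal to $r$. Let $V=K[x,y]_1$, so that closed points of $\mathbb P(\mathrm{Sym}^nV)$ are nonzero binary forms of degree $n$ up to scalars, and let $$f_\lambda:\ Y_\lambda=\prod_{r=1}^d\mathbb P(\mathrm{Sym}^{e_r}V)\to\mathbb P(\mathrm{Sym}^dV)=\mathbb P^d_K,\qquad (G_1,\dots,G_d)\mapsto\prod_{r=1}^dG_r^{\,r}.$$ Let $X_\lambda=\mathrm{im}(f_\lambda)$ be the coincident root locus, considered as a closed subscheme of $\mathbb P^d_K$ with its reduced structure. Let $\mathrm{Sing}(X_\lambda)$ be the set of points of $X_\lambda$ whose local ring is not regular. Then either $X_\lambda$ is smooth over $K$ and $\mathrm{Sing}(X_\lambda)=\emptyset$, or $\mathrm{Sing}(X_\lambda)$ has codimension exactly one in $X_\lambda$, that is, $\min_{z\in\mathrm{Sing}(X_\lambda)}\dim\mathcal O_{X_\lambda,z}=1$ (in particular, $\mathrm{Sing}(X_\lambda)\neq\emptyset$).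 -/

import Mathlib

open AlgebraicGeometry CategoryTheory
open scoped LinearAlgebra.Projectivization

universe u

noncomputable section

namespace CoincidentRoot

attribute [local instance] MvPolynomial.gradedAlgebra

/-- `Sym^n V`, where `V = K[x, y]₁`: the binary forms of degree `n` in `x = X 0` and `y = X 1`. -/
abbrev BinaryForm (K : Type u) [Field K] (n : ℕ) : Type u :=
  MvPolynomial.homogeneousSubmodule (Fin 2) K n

/-- The coefficients `(a_0, …, a_n)` of the form `F = ∑ j, a_j x^(n-j) y^j`. -/
def coeffs {K : Type u} [Field K] {n : ℕ} (F : BinaryForm K n) : Fin (n + 1) → K :=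
  fun j => MvPolynomial.coeff
    (Finsupp.single (0 : Fin 2) (n - (j : ℕ)) + Finsupp.single (1 : Fin 2) (j : ℕ)) F.1

/-- `e_r`, the number of parts of `lam` that are equal to `r`. -/
def mult {d : ℕ} (lam : d.Partition) (r : ℕ) : ℕ := lam.parts.count r

theorem sum_mult {d : ℕ} (lam : d.Partition) :
    ∑ r : Fin d, mult lam ((r : ℕ) + 1) * ((r : ℕ) + 1) = d := by
  have h1 : ∑ r ∈ Finset.range (d + 1), mult lam r * r = d := by
    conv_rhs => rw [← lam.parts_sum, Finset.sum_multiset_count]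
    symm
    simp only [smul_eq_mul]
    refine Finset.sum_subset (fun m hm => ?_) (fun m _ hm => ?_)
    · exact Finset.mem_range.2
        (Nat.lt_succ_of_le (lam.le_of_mem_parts (Multiset.mem_toFinset.1 hm)))
    · rw [Multiset.mem_toFinset] at hm
      simp [hm]
  rw [Finset.sum_range_succ'] at h1
  rw [Fin.sum_univ_eq_sum_range (fun r => mult lam (r + 1) * (r + 1)) d]
  simpa using h1

/-- The product `∏_r G_r ^ r`, `1 ≤ r ≤ d`, of binary forms `G_r` of degree `e_r`. The index
`r : Fin d` stands for the part size `r + 1`. -/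
def prodForm {K : Type u} [Field K] {d : ℕ} (lam : d.Partition)
    (G : (r : Fin d) → BinaryForm K (mult lam ((r : ℕ) + 1))) : BinaryForm K d :=
  ⟨∏ r : Fin d, (G r).1 ^ ((r : ℕ) + 1), by
    have h := MvPolynomial.IsHomogeneous.prod Finset.univ
      (fun r : Fin d => (G r).1 ^ ((r : ℕ) + 1))
      (fun r : Fin d => mult lam ((r : ℕ) + 1) * ((r : ℕ) + 1))
      (fun r _ => MvPolynomial.IsHomogeneous.pow (G r).2 ((r : ℕ) + 1))
    rw [sum_mult lam] at h
    exact h⟩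

theorem prodForm_ne_zero {K : Type u} [Field K] {d : ℕ} (lam : d.Partition)
    (G : (r : Fin d) → BinaryForm K (mult lam ((r : ℕ) + 1))) (hG : ∀ r, G r ≠ 0) :
    prodForm lam G ≠ 0 := by
  intro h
  have h' : ∏ r : Fin d, (G r).1 ^ ((r : ℕ) + 1) = 0 := congrArg Subtype.val h
  obtain ⟨r, -, hr⟩ := Finset.prod_eq_zero_iff.1 h'
  exact hG r (Subtype.ext (pow_eq_zero_iff (Nat.succ_ne_zero _) |>.1 hr))

/-- The closed points of `Y_λ = ∏_r ℙ(Sym^(e_r) V)`. -/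
abbrev SourcePoints (K : Type u) [Field K] {d : ℕ} (lam : d.Partition) : Type u :=
  (r : Fin d) → ℙ K (BinaryForm K (mult lam ((r : ℕ) + 1)))

/-- The map `f_λ : Y_λ → ℙ(Sym^d V)`, `(G_1, …, G_d) ↦ ∏_r G_r ^ r`, on closed points. It does not
depend on the representatives, see `multMap_mk`. -/
def multMap (K : Type u) [Field K] {d : ℕ} (lam : d.Partition) (G : SourcePoints K lam) :
    ℙ K (BinaryForm K d) :=
  Projectivization.mk K (prodForm lam fun r => (G r).rep)
    (prodForm_ne_zero lam _ fun r => (G r).rep_nonzero)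

theorem multMap_mk {K : Type u} [Field K] {d : ℕ} (lam : d.Partition)
    (G : (r : Fin d) → BinaryForm K (mult lam ((r : ℕ) + 1))) (hG : ∀ r, G r ≠ 0) :
    multMap K lam (fun r => Projectivization.mk K (G r) (hG r)) =
      Projectivization.mk K (prodForm lam G) (prodForm_ne_zero lam G hG) := by
  choose a ha using fun r => Projectivization.exists_smul_eq_mk_rep K (G r) (hG r)
  rw [multMap, Projectivization.mk_eq_mk_iff]
  refine ⟨∏ r : Fin d, a r ^ ((r : ℕ) + 1), Subtype.ext ?_⟩
  have ha' : ∀ r, (Projectivization.mk K (G r) (hG r)).rep.1 = (a r : K) • (G r).1 :=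
    fun r => (congrArg Subtype.val (ha r)).symm
  simp only [prodForm, ha', Units.smul_def, Submodule.coe_smul, Units.coe_prod, Units.val_pow_eq_pow_val,
    smul_pow, Finset.prod_smul]

/-- The homogeneous polynomials `P` in `K[z_0, …, z_d]` that vanish on the image of `f_λ`; they
generate the homogeneous ideal `I(X_λ)`. -/
def vanishingPolys (K : Type u) [Field K] {d : ℕ} (lam : d.Partition) :
    Set (MvPolynomial (Fin (d + 1)) K) :=
  {P | (∃ m : ℕ, P.IsHomogeneous m) ∧
    ∀ p ∈ Set.range (multMap K lam), MvPolynomial.eval (coeffs p.rep) P = 0}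

/-- The projective space `ℙ^d = ℙ(Sym^d V)` as a scheme, with homogeneous coordinates
`z_0, …, z_d`: the point `(a_0 : … : a_d)` is the form `∑ j, a_j x^(d-j) y^j`. -/
abbrev ProjSpace (K : Type u) [Field K] (d : ℕ) : Scheme.{u} :=
  Proj (MvPolynomial.homogeneousSubmodule (Fin (d + 1)) K)

/-- The structure morphism `ℙ^d → Spec K`. -/
def ProjSpace.toSpec (K : Type u) [Field K] (d : ℕ) : ProjSpace K d ⟶ Spec (.of K) :=
  Proj.toSpecZero (MvPolynomial.homogeneousSubmodule (Fin (d + 1)) K) ≫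
    Spec.map (CommRingCat.ofHom
      (algebraMap K (MvPolynomial.homogeneousSubmodule (Fin (d + 1)) K 0)))

/-- The closed subset of `ℙ^d` cut out by `I(X_λ)`, that is the Zariski closure of `im f_λ`. -/
def closedLocus (K : Type u) [Field K] {d : ℕ} (lam : d.Partition) :
    TopologicalSpace.Closeds (ProjSpace K d) :=
  ⟨ProjectiveSpectrum.zeroLocus (MvPolynomial.homogeneousSubmodule (Fin (d + 1)) K)
      (vanishingPolys K lam),
    ProjectiveSpectrum.isClosed_zeroLocus _ _⟩

/-- The coincident root locus `X_λ = im f_λ`, as a closed subscheme of `ℙ^d` with its reduced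
structure. -/
def coincidentRootLocus (K : Type u) [Field K] {d : ℕ} (lam : d.Partition) : Scheme.{u} :=
  (Scheme.IdealSheafData.vanishingIdeal (closedLocus K lam)).subscheme

/-- The structure morphism `X_λ → Spec K`. -/
def coincidentRootLocus.toSpec (K : Type u) [Field K] {d : ℕ} (lam : d.Partition) :
    coincidentRootLocus K lam ⟶ Spec (.of K) :=
  (Scheme.IdealSheafData.vanishingIdeal (closedLocus K lam)).subschemeι ≫ ProjSpace.toSpec K d

/-- The singular locus: the points whose local ring is not regular. -/
def singularLocus (X : Scheme.{u}) : Set X :=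
  {x | ¬ IsRegularLocalRing (X.presheaf.stalk x)}

/-- The codimension `codim(Z, X) = inf_{z ∈ Z} dim 𝒪_{X,z}` of a closed subset `Z` of `X`; it is
`⊤` if `Z` is empty. -/
def codim {X : Scheme.{u}} (Z : Set X) : WithBot ℕ∞ :=
  ⨅ z ∈ Z, ringKrullDim (X.presheaf.stalk z)

end CoincidentRoot

end

/-! Cover `X_λ` by the open sets of forms `F` with `F(1, c) ≠ 0`, for `c` in `K`. Scaled to take the
value `1` at `c`, such a form dehomogenizes to `∏ (1 + t_l (Y - c)) ^ m_l`, with one parameter `t_l`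
for each part `l` of size `m_l`. The coordinate ring of the chart is therefore the subalgebra of `R
= K[t_l]` generated by the coefficients of this generic product. Reversing and translating the
polynomial turns these generators into the coefficients of `∏ (X + t_l) ^ m_l`, so every chart has
the same ring `A = coeffAlgebra K m` (`chartHom_range`, `chartQuotientEquiv`).

If all `m_l` equal `r`, an `r`-th root can be extracted coefficientwise in characteristic zero.
Hence `A` is the ring of symmetric polynomials, a polynomial ring, and `X_λ` is smooth
(`coeffAlgebra_const`).

If `m_i ≠ m_j`, then `A` fails to be normal in codimension one. Let `b` be the sum of the `t_l` with
`m_l = m_i`. It is integral over `A`, and by Galois theory it lies in the fraction field of `A`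
(`exists_mul_sum_mem_coeffAlgebra`). Let `q` be the trace on `A` of the prime `(t_i - t_j)` of `R`;
integrality gives it height one. Over `t_i = t_j`, moving `t_i` by `m_j ε` and `t_j` by `-m_i ε`
leaves every element of `A` unchanged to first order (`deform_eq_of_mem_coeffAlgebra`), but changes
`b` by `m_j ε`. So `b` is not in `A_q`, and `A_q` is not integrally closed, hence not regular.
Codimension zero cannot occur, because the local rings are domains and a zero-dimensional local
domain is a field. -/

open Polynomial

noncomputable section

namespace CoincidentRoot

/-! ### Polynomials with prescribed root multiplicities. -/

section WeightedProd

variable {ι : Type*} [Fintype ι]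

/-- The monic polynomial `∏ l, (X + t l) ^ m l` with roots `-t l` of multiplicities `m l`. -/
def weightedProd {R : Type*} [CommRing R] (m : ι → ℕ) (t : ι → R) : R[X] :=
  ∏ l, (X + C (t l)) ^ m l

theorem weightedProd_monic {R : Type*} [CommRing R] (m : ι → ℕ) (t : ι → R) :
    (weightedProd m t).Monic :=
  monic_prod_of_monic _ _ fun _ _ => (monic_X_add_C _).pow _

theorem weightedProd_map {R S : Type*} [CommRing R] [CommRing S] (f : R →+* S) (m : ι → ℕ)
    (t : ι → R) : (weightedProd m t).map f = weightedProd m (fun l => f (t l)) := by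
  simp [weightedProd, Polynomial.map_prod]

theorem weightedProd_eval_neg {R : Type*} [CommRing R] {m : ι → ℕ} (hm : ∀ l, 0 < m l)
    (t : ι → R) (l : ι) : (weightedProd m t).eval (-t l) = 0 := by
  rw [weightedProd, eval_prod]
  exact Finset.prod_eq_zero (Finset.mem_univ l) (by simp [(hm l).ne'])

/-- Coinciding roots add their multiplicities. For injective `t` the sum has at most one term, so
the polynomial determines which roots carry which multiplicity. -/
theorem weightedProd_rootMultiplicity {L : Type*} [Field L] [DecidableEq L] (m : ι → ℕ)
    (t : ι → L) (x : L) :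
    (weightedProd m t).rootMultiplicity (-x) = ∑ l with t l = x, m l := by
  have h0 : weightedProd m t ≠ 0 := (weightedProd_monic m t).ne_zero
  rw [← count_roots, weightedProd, roots_prod _ _ h0, Multiset.count_bind, Finset.sum_filter]
  refine Finset.sum_congr rfl fun l _ => ?_
  rw [roots_pow, ← sub_neg_eq_add, ← C_neg, roots_X_sub_C, Multiset.count_nsmul,
    Multiset.count_singleton]
  simp [eq_comm]

/-- The sum of the roots of a given multiplicity is determined by the polynomial. -/
theorem sum_eq_of_weightedProd_eq {L : Type*} [Field L] {m : ι → ℕ} (hm : ∀ l, 0 < m l)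
    {s t : ι → L} (hs : Function.Injective s) (ht : Function.Injective t)
    (h : weightedProd m s = weightedProd m t) (r : ℕ) :
    ∑ l with m l = r, s l = ∑ l with m l = r, t l := by
  classical
  -- The set of roots of multiplicity `r` is read off from the polynomial alone; `r > 0` excludes
  -- the points that are not roots.
  have key : ∀ {s : ι → L}, Function.Injective s → 0 < r → ∀ x,
      x ∈ (Finset.univ.filter fun l => m l = r).image s ↔
        (weightedProd m s).rootMultiplicity (-x) = r := by
    intro s hs hr x
    rw [weightedProd_rootMultiplicity]
    by_cases hx : ∃ l, s l = x
    · obtain ⟨l, rfl⟩ := hx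
      simp [Finset.sum_filter, hs.eq_iff]
    · push Not at hx
      simp [hx, hr.ne]
  rcases Nat.eq_zero_or_pos r with rfl | hr
  · simp [Finset.filter_false_of_mem fun l _ => (hm l).ne']
  · have himg : (Finset.univ.filter fun l => m l = r).image s =
        (Finset.univ.filter fun l => m l = r).image t := by
      ext x
      rw [key hs hr, key ht hr, h]
    have := congrArg (fun F : Finset L => ∑ x ∈ F, x) himg
    simpa [Finset.sum_image hs.injOn, Finset.sum_image ht.injOn] using this

end WeightedProd

/-! ### The coefficient algebra: integrality of the roots, and its fraction field. -/

section CoeffAlgebra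

variable {ι : Type*} [Fintype ι] (K : Type*) [Field K] (m : ι → ℕ)

/-- The algebra generated by the coefficients of the generic polynomial with root multiplicities
`m`. -/
def coeffAlgebra : Subalgebra K (MvPolynomial ι K) :=
  Algebra.adjoin K (Set.range
    (weightedProd m (MvPolynomial.X : ι → MvPolynomial ι K)).coeff)

theorem coeff_mem_coeffAlgebra (k : ℕ) :
    (weightedProd m (MvPolynomial.X : ι → MvPolynomial ι K)).coeff k ∈ coeffAlgebra K m :=
  Algebra.subset_adjoin ⟨k, rfl⟩

theorem exists_lift_weightedProd : ∃ Q : (coeffAlgebra K m)[X], Q.Monic ∧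
    Q.map (algebraMap (coeffAlgebra K m) (MvPolynomial ι K)) =
      weightedProd m (MvPolynomial.X : ι → MvPolynomial ι K) := by
  have h : weightedProd m (MvPolynomial.X : ι → MvPolynomial ι K) ∈
      lifts (algebraMap (coeffAlgebra K m) (MvPolynomial ι K)) := by
    rw [lifts_iff_coeff_lifts]
    exact fun k => ⟨⟨_, coeff_mem_coeffAlgebra K m k⟩, rfl⟩
  obtain ⟨Q, hQ, -, hm⟩ := lifts_and_natDegree_eq_and_monic h (weightedProd_monic _ _)
  exact ⟨Q, hm, hQ⟩

variable {K m}

/-- Each `-X l` is a root of the generic polynomial, which is monic with coefficients in the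
algebra. -/
theorem isIntegral_coeffAlgebra (hm : ∀ l, 0 < m l) :
    Algebra.IsIntegral (coeffAlgebra K m) (MvPolynomial ι K) := by
  obtain ⟨Q, hQ, hQm⟩ := exists_lift_weightedProd K m
  refine ⟨fun p => ?_⟩
  induction p using MvPolynomial.induction_on with
  | C a => exact isIntegral_algebraMap (x := algebraMap K (coeffAlgebra K m) a)
  | add p q hp hq => exact hp.add hq
  | mul_X p l hp =>
    refine hp.mul ?_
    rw [← neg_neg (MvPolynomial.X l)]
    refine IsIntegral.neg ⟨Q, hQ, ?_⟩
    rw [← Polynomial.eval_map, hQm, weightedProd_eval_neg hm]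

/-- The sum of the roots of multiplicity `r` lies in the fraction field of the coefficient
algebra. -/
theorem exists_mul_sum_mem_coeffAlgebra [CharZero K] (hm : ∀ l, 0 < m l) (r : ℕ) :
    ∃ s ∈ coeffAlgebra K m, s ≠ 0 ∧
      s * ∑ l with m l = r, (MvPolynomial.X l : MvPolynomial ι K) ∈ coeffAlgebra K m := by
  classical
  let R := MvPolynomial ι K
  let L := FractionRing R
  let φ : R →ₐ[K] L := IsScalarTower.toAlgHom K R L
  have hφ : Function.Injective φ := IsFractionRing.injective R L
  -- `k` is the fraction field of the coefficient algebra inside `L`. The generic polynomial has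
  -- coefficients in `k`, and its roots generate `L`, so `L` is a splitting field over `k`.
  let k : IntermediateField K L := IntermediateField.adjoin K (φ '' (coeffAlgebra K m : Set R))
  have hmem : ∀ a ∈ coeffAlgebra K m, φ a ∈ k := fun a ha =>
    IntermediateField.subset_adjoin _ _ ⟨a, ha, rfl⟩
  let t : ι → L := fun l => φ (MvPolynomial.X l)
  have ht : Function.Injective t := hφ.comp (MvPolynomial.X_injective)
  have hG : weightedProd m t ∈ lifts (algebraMap k L) := by
    rw [lifts_iff_coeff_lifts]
    intro n
    have : (weightedProd m t).coeff n = φ ((weightedProd m (MvPolynomial.X : ι → R)).coeff n) := by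
      have := weightedProd_map (φ : R →+* L) m MvPolynomial.X
      rw [show t = fun l => (φ : R →+* L) (MvPolynomial.X l) from rfl, ← this, coeff_map]
      rfl
    exact ⟨⟨_, hmem _ (coeff_mem_coeffAlgebra K m n)⟩, this.symm⟩
  obtain ⟨Q, hQ⟩ := (mem_lifts _).1 hG
  have hsplit : IsSplittingField k L Q := by
    rw [isSplittingField_iff_intermediateField, hQ]
    refine ⟨Splits.prod fun l _ => (Splits.X_add_C _).pow _, ?_⟩
    have hsub : ∀ p : R, φ p ∈ IntermediateField.adjoin k (Q.rootSet L) := by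
      intro p
      induction p using MvPolynomial.induction_on with
      | C a =>
        have : φ (MvPolynomial.C a) = algebraMap k L (algebraMap K k a) :=
          φ.commutes a
        rw [this]
        exact IntermediateField.algebraMap_mem _ _
      | add p q hp hq => rw [map_add]; exact add_mem hp hq
      | mul_X p l hp =>
        rw [map_mul]
        refine mul_mem hp ?_
        rw [← neg_neg (φ (MvPolynomial.X l))]
        refine neg_mem (IntermediateField.subset_adjoin _ _ ?_)
        rw [mem_rootSet', hQ]
        refine ⟨(weightedProd_monic m t).ne_zero, ?_⟩
        rw [aeval_def, ← Polynomial.eval_map, hQ]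
        exact weightedProd_eval_neg hm t l
    rw [eq_top_iff]
    intro x _
    obtain ⟨a, b, -, rfl⟩ := IsFractionRing.div_surjective (A := R) x
    exact div_mem (hsub a) (hsub b)
  have : FiniteDimensional k L := IsSplittingField.finiteDimensional L Q
  have : Normal k L := Normal.of_isSplittingField Q
  have : CharZero L := charZero_of_injective_algebraMap (algebraMap K L).injective
  have : CharZero k := charZero_of_injective_algebraMap (algebraMap K k).injective
  have : IsGalois k L := ⟨⟩
  -- An automorphism over `k` fixes the generic polynomial, so it permutes the roots of multiplicity
  -- `r` and fixes their sum.
  have hfix : ∑ l with m l = r, t l ∈ (⊥ : IntermediateField k L) := by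
    rw [IsGalois.mem_bot_iff_fixed]
    intro σ
    rw [map_sum]
    refine sum_eq_of_weightedProd_eq hm (s := fun l => σ (t l)) (σ.injective.comp ht) ht ?_ r
    have h1 := weightedProd_map (σ : L →+* L) m t
    rw [← hQ, Polynomial.map_map] at h1
    have h2 : (σ : L →+* L).comp (algebraMap k L) = algebraMap k L :=
      RingHom.ext fun x => σ.commutes x
    rw [h2, hQ] at h1
    exact h1.symm
  obtain ⟨y, hy⟩ := IntermediateField.mem_bot.1 hfix
  obtain ⟨a, ha, b, hb, hab⟩ := IntermediateField.mem_adjoin_iff_div.1 y.2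
  have himg : Algebra.adjoin K (φ '' (coeffAlgebra K m : Set R)) = (coeffAlgebra K m).map φ := by
    rw [← AlgHom.map_adjoin, Algebra.adjoin_eq]
  rw [himg] at ha hb
  obtain ⟨a, ha, rfl⟩ := ha
  obtain ⟨b, hb, rfl⟩ := hb
  have hsum : ∑ l with m l = r, t l = φ (∑ l with m l = r, MvPolynomial.X l) :=
    (map_sum φ _ _).symm
  have hy' : (y : L) = φ (∑ l with m l = r, MvPolynomial.X l) := hy.trans hsum
  rw [hy'] at hab
  -- The quotient `a / b` may have `b = 0`, where division returns `0`; the sum is then `0` and the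
  -- denominator `1` serves.
  by_cases hb0 : b = 0
  · have h0 : (∑ l with m l = r, MvPolynomial.X l : R) = 0 := by
      apply hφ
      rw [hab, hb0]
      simp
    refine ⟨1, one_mem _, one_ne_zero, ?_⟩
    rw [one_mul]
    exact h0 ▸ zero_mem _
  · refine ⟨b, hb, hb0, ?_⟩
    have hb1 : φ b ≠ 0 := fun h => hb0 (hφ (h.trans (map_zero φ).symm))
    have : b * ∑ l with m l = r, MvPolynomial.X l = a := by
      apply hφ
      rw [map_mul, hab]
      exact mul_div_cancel₀ _ hb1
    rw [this]
    exact ha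

end CoeffAlgebra

/-! ### Normality and heights in integral extensions. -/

section IntegralExtension

/-- A regular local domain of dimension one is integrally closed. -/
theorem isIntegrallyClosed_of_ringKrullDim_eq_one (R : Type*) [CommRing R] [IsDomain R]
    [h : IsRegularLocalRing R] (hd : ringKrullDim R = 1) : IsIntegrallyClosed R := by
  have h1 := (IsRegularLocalRing.iff_finrank_cotangentSpace R).1 h
  rw [hd] at h1
  have h2 : Module.finrank (IsLocalRing.ResidueField R) (IsLocalRing.CotangentSpace R) ≤ 1 := by
    exact_mod_cast h1.le
  have : IsPrincipalIdealRing R :=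
    ((tfae_of_isNoetherianRing_of_isLocalRing_of_isDomain R).out 0 5).2 h2
  infer_instance

/-- If the localization of `A` at `q` is integrally closed, then integral elements of the fraction
field of `A` have a denominator outside `q`. -/
theorem exists_notMem_mul_mem_of_isIntegrallyClosed {A C : Type*} [CommRing A] [CommRing C]
    [IsDomain C] [Algebra A C] [FaithfulSMul A C] [IsDomain A] (q : Ideal A) [q.IsPrime]
    (S : Type*) [CommRing S] [IsDomain S] [Algebra A S] [IsLocalization.AtPrime S q]
    [IsIntegrallyClosed S] {b : C} (hb : IsIntegral A b) {s a : A}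
    (hs : s ≠ 0) (hab : algebraMap A C s * b = algebraMap A C a) :
    ∃ s' ∉ q, ∃ a', algebraMap A C s' * b = algebraMap A C a' := by
  let L := FractionRing C
  let F := FractionRing S
  have hAL : Function.Injective (algebraMap A L) := FaithfulSMul.algebraMap_injective A L
  have hCL : Function.Injective (algebraMap C L) := IsFractionRing.injective C L
  -- Embeds the localization `S`, and then its fraction field `F`, into the fraction field of `C`,
  -- where `b` can be compared with the fraction `a / s`.
  let g : S →+* L := IsLocalization.lift (M := q.primeCompl) (g := algebraMap A L) fun y => by
    rw [isUnit_iff_ne_zero, Ne, map_eq_zero_iff _ hAL]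
    rintro h0
    exact y.2 (h0 ▸ q.zero_mem)
  let _ : Algebra S L := g.toAlgebra
  have : IsScalarTower A S L := IsScalarTower.of_algebraMap_eq fun x => by
    rw [RingHom.algebraMap_toAlgebra, IsLocalization.lift_eq]
  have hSL : Function.Injective (algebraMap S L) := by
    rw [RingHom.algebraMap_toAlgebra, IsLocalization.lift_injective_iff]
    intro x y
    rw [hAL.eq_iff, (IsLocalization.injective S q.primeCompl_le_nonZeroDivisors).eq_iff]
  let f : F →ₐ[S] L := IsFractionRing.liftAlgHom (g := Algebra.ofId S L) hSL
  have hf : Function.Injective f := f.toRingHom.injective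
  have hfA : ∀ x : A, f (algebraMap S F (algebraMap A S x)) = algebraMap C L (algebraMap A C x) := by
    intro x
    rw [f.commutes, ← IsScalarTower.algebraMap_apply A S L, ← IsScalarTower.algebraMap_apply A C L]
  let x : F := algebraMap S F (algebraMap A S a) / algebraMap S F (algebraMap A S s)
  have hs0 : algebraMap C L (algebraMap A C s) ≠ 0 := by
    rw [← IsScalarTower.algebraMap_apply A C L, Ne, map_eq_zero_iff _ hAL]
    exact hs
  have hx : f x = algebraMap C L b := by
    simp only [x, map_div₀, hfA]
    rw [← hab, map_mul, mul_div_cancel_left₀ _ hs0]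
  have hbL : IsIntegral S (algebraMap C L b) := by
    have : IsIntegral A (algebraMap C L b) := hb.map (IsScalarTower.toAlgHom A C L)
    exact this.tower_top
  rw [← hx, isIntegral_algHom_iff f hf] at hbL
  obtain ⟨y, hy⟩ := IsIntegrallyClosed.isIntegral_iff.1 hbL
  obtain ⟨⟨a', s'⟩, hs'⟩ := IsLocalization.surj q.primeCompl y
  refine ⟨s', s'.2, a', hCL ?_⟩
  have h1 := congrArg (fun z => f (algebraMap S F z)) hs'
  simp only [map_mul, hfA, hy, hx] at h1
  rw [map_mul, mul_comm]
  exact h1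

/-- The dimension does not drop along integral extensions. -/
theorem ringKrullDim_le_of_isIntegral (A C : Type*) [CommRing A] [CommRing C]
    [Algebra A C] [FaithfulSMul A C] [Algebra.IsIntegral A C] :
    ringKrullDim A ≤ ringKrullDim C := by
  refine iSup_le fun l => ?_
  -- Lying over lifts the smallest prime of the chain; going up lifts the others.
  obtain ⟨P, hP, hPl⟩ :=
    (inferInstance : Nonempty ((RelSeries.head l).asIdeal.primesOver C)).some
  have := hP
  obtain ⟨l', hl', -, -⟩ := Ideal.exists_ltSeries_of_hasGoingUp (S := C) l P
  rw [← hl']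
  exact le_iSup (fun l : LTSeries (PrimeSpectrum C) => (l.length : WithBot ℕ∞)) l'

/-- In an integral extension `C` of `A`, a prime of `A` under a prime `P` with `dim C ≤ dim C/P + 1`
has height at most one. -/
theorem height_comap_ker_le_one {A C B : Type*} [CommRing A] [CommRing C] [CommRing B] [IsDomain B]
    [Algebra A C] [FaithfulSMul A C] [Algebra.IsIntegral A C] (f : C →+* B)
    (hf : Function.Surjective f) {n : ℕ} (hC : ringKrullDim C = (n + 1 : ℕ))
    (hB : ringKrullDim B = n) :
    (RingHom.ker (f.comp (algebraMap A C))).height ≤ 1 := by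
  let φ : PrimeSpectrum C → PrimeSpectrum A := PrimeSpectrum.comap (algebraMap A C)
  let ψ : PrimeSpectrum B → PrimeSpectrum C := PrimeSpectrum.comap f
  have hφ : StrictMono φ := fun P Q h => Ideal.IsIntegral.comap_lt_comap h
  have hψ : StrictMono ψ := by
    refine Monotone.strictMono_of_injective (fun P Q h => Ideal.comap_mono h) ?_
    exact PrimeSpectrum.comap_injective_of_surjective f hf
  let q : PrimeSpectrum A := φ (ψ ⊥)
  have hq : q.asIdeal = RingHom.ker (f.comp (algebraMap A C)) := rfl
  -- A chain of primes of `B` stays strict in `C` by surjectivity and in `A` by incomparability. So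
  -- at least `n` steps lie above `q`, and since `dim A ≤ n + 1` at most one lies below.
  have h1 : (n : ℕ∞) ≤ Order.coheight q := by
    refine le_trans ?_ ((Order.coheight_le_coheight_apply_of_strictMono ψ hψ ⊥).trans
      (Order.coheight_le_coheight_apply_of_strictMono φ hφ _))
    have : ((Order.coheight (⊥ : PrimeSpectrum B) : ℕ∞) : WithBot ℕ∞) = (n : ℕ∞) :=
      Order.coheight_bot_eq_krullDim.trans hB
    exact (WithBot.coe_injective this).ge
  have h2 : Order.height q + Order.coheight q ≤ (n + 1 : ℕ) := by
    have h3 : ringKrullDim A ≤ ((n + 1 : ℕ) : ℕ∞) :=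
      (ringKrullDim_le_of_isIntegral A C).trans hC.le
    have : Nonempty (PrimeSpectrum A) := ⟨q⟩
    rw [ringKrullDim, Order.krullDim_eq_iSup_height_add_coheight_of_nonempty,
      WithBot.coe_le_coe] at h3
    exact (le_iSup (fun a : PrimeSpectrum A => Order.height a + Order.coheight a) q).trans h3
  rw [← hq, PrimeSpectrum.height_eq_orderHeight]
  have h4 : Order.height q + n ≤ 1 + n := by
    refine (add_le_add_right h1 _).trans (h2.trans ?_)
    rw [add_comm]
    simp
  exact (ENat.add_le_add_iff_right (ENat.natCast_ne_top n)).1 h4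

end IntegralExtension

/-! ### Distinct multiplicities: failure of normality in codimension one. -/

section NonNormal

variable {ι : Type*} [DecidableEq ι] (K : Type*) [Field K] {m : ι → ℕ} {i j : ι}

/-- The substitution `X j ↦ X i`. -/
def identify (hij : i ≠ j) :
    MvPolynomial ι K →ₐ[K] MvPolynomial {l // l ≠ j} K :=
  MvPolynomial.aeval fun l => MvPolynomial.X (if h : l ≠ j then ⟨l, h⟩ else ⟨i, hij⟩)

theorem identify_surjective (hij : i ≠ j) : Function.Surjective (identify K hij) := by
  rw [← AlgHom.range_eq_top, eq_top_iff, ← MvPolynomial.adjoin_range_X, Algebra.adjoin_le_iff]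
  rintro _ ⟨l, rfl⟩
  exact ⟨MvPolynomial.X l.1, by simp [identify, l.2]⟩

theorem identify_X_eq (hij : i ≠ j) :
    identify K hij (MvPolynomial.X j) = identify K hij (MvPolynomial.X i) := by
  rw [identify, MvPolynomial.aeval_X, MvPolynomial.aeval_X]
  simp [hij]

/-- The first order deformation of `identify` which moves the two roots so that their weighted sum
stays constant. -/
def deform (m : ι → ℕ) (hij : i ≠ j) :
    MvPolynomial ι K →ₐ[K] DualNumber (MvPolynomial {l // l ≠ j} K) :=
  MvPolynomial.aeval fun l => TrivSqZeroExt.inl (identify K hij (MvPolynomial.X l)) +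
    TrivSqZeroExt.inr (if l = i then (m j : MvPolynomial {l // l ≠ j} K)
      else if l = j then -(m i : MvPolynomial {l // l ≠ j} K) else 0)

theorem add_pow_of_mul_self_eq_zero {R : Type*} [CommRing R] (x e : R) (he : e * e = 0) (n : ℕ) :
    (x + e) ^ n = x ^ n + n * x ^ (n - 1) * e := by
  induction n with
  | zero => simp
  | succ n ih =>
    rw [pow_succ, ih]
    rcases n with _ | n
    · simp
    · push_cast
      linear_combination ((n : R) + 1) * x ^ n * he

/-- In `(X + t i + m j e) ^ m i * (X + t i - m i e) ^ m j` the two first-order terms are `± m i m j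
e (X + t i) ^ (m i + m j - 1)` and cancel; the second-order term vanishes because `e * e = 0`. -/
theorem weightedProd_eq_of_deform {R : Type*} [CommRing R] [Fintype ι] (hij : i ≠ j) {s t : ι → R}
    (e : R) (he : e * e = 0) (hl : ∀ l, l ≠ i → l ≠ j → s l = t l) (ht : t j = t i)
    (hi : s i = t i + m j * e) (hj : s j = t i - m i * e) :
    weightedProd m s = weightedProd m t := by
  have hmem : i ∈ Finset.univ.erase j := Finset.mem_erase.2 ⟨hij, Finset.mem_univ _⟩
  rw [weightedProd, weightedProd, ← Finset.mul_prod_erase _ _ (Finset.mem_univ j),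
    ← Finset.mul_prod_erase _ _ (Finset.mem_univ j), ← Finset.mul_prod_erase _ _ hmem,
    ← Finset.mul_prod_erase _ _ hmem, ← mul_assoc, ← mul_assoc]
  congr 1
  · rw [hi, hj, ht]
    have he' : (C e : R[X]) * C e = 0 := by rw [← C_mul, he, C_0]
    have h1 : X + C (t i - m i * e) = (X + C (t i)) + (-(m i : R[X]) * C e) := by
      simp only [C_sub, C_mul, C_eq_natCast]
      ring
    have h2 : X + C (t i + m j * e) = (X + C (t i)) + (m j : R[X]) * C e := by
      simp only [C_add, C_mul, C_eq_natCast]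
      ring
    rw [h1, h2, add_pow_of_mul_self_eq_zero _ (-(m i : R[X]) * C e),
      add_pow_of_mul_self_eq_zero _ ((m j : R[X]) * C e)]
    · rcases m i with _ | a
      · simp
      · rcases m j with _ | b
        · simp
        · simp only [Nat.add_one_sub_one]
          push_cast
          linear_combination (-((b : R[X]) + 1) * (X + C (t i)) ^ b * (a + 1) *
            (a + 1) * (X + C (t i)) ^ a * (b + 1)) * he'
    · linear_combination (m j : R[X]) * m j * he'
    · linear_combination (m i : R[X]) * m i * he'
  · refine Finset.prod_congr rfl fun l hl' => ?_
    obtain ⟨hli, hlj⟩ : l ≠ i ∧ l ≠ j := by simpa using hl'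
    rw [hl l hli hlj]

variable [Fintype ι]

/-- It suffices to check the generators. There both maps give the coefficients of one polynomial
over the dual numbers, by `weightedProd_eq_of_deform` with `e = ε`. -/
theorem deform_eq_of_mem_coeffAlgebra (hij : i ≠ j) {a : MvPolynomial ι K}
    (ha : a ∈ coeffAlgebra K m) : deform K m hij a = TrivSqZeroExt.inl (identify K hij a) := by
  let B := MvPolynomial {l // l ≠ j} K
  let f : MvPolynomial ι K →ₐ[K] DualNumber B :=
    (TrivSqZeroExt.inlAlgHom K B B).comp (identify K hij)
  suffices h : coeffAlgebra K m ≤ AlgHom.equalizer (deform K m hij) f from h ha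
  refine Algebra.adjoin_le ?_
  rintro _ ⟨k, rfl⟩
  suffices h : (weightedProd m (MvPolynomial.X : ι → MvPolynomial ι K)).map
      (deform K m hij : MvPolynomial ι K →+* DualNumber B) =
      (weightedProd m (MvPolynomial.X : ι → MvPolynomial ι K)).map
      (f : MvPolynomial ι K →+* DualNumber B) by
    have := congrArg (fun p => p.coeff k) h
    rw [coeff_map, coeff_map] at this
    exact this
  rw [weightedProd_map, weightedProd_map]
  have hf : ∀ l, f (MvPolynomial.X l) =
      TrivSqZeroExt.inl (identify K hij (MvPolynomial.X l)) := fun l => rfl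
  have hd : ∀ l, deform K m hij (MvPolynomial.X l) =
      TrivSqZeroExt.inl (identify K hij (MvPolynomial.X l)) +
      TrivSqZeroExt.inr (if l = i then (m j : B) else if l = j then -(m i : B) else 0) :=
    fun l => MvPolynomial.aeval_X _ _
  have hX := identify_X_eq K hij
  refine weightedProd_eq_of_deform hij DualNumber.eps DualNumber.eps_mul_eps ?_ ?_ ?_ ?_
  · intro l hli hlj
    simp [hd, hf, hli, hlj]
  · simp [hf, hX]
  · simp only [AlgHom.coe_toRingHom, hd, hf]
    ext <;> simp
  · simp only [AlgHom.coe_toRingHom, hd, hf, hX]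
    ext <;> simp [hij.symm]

/-- If two multiplicities differ, then the coefficient algebra has a prime ideal of height one at
which it is not regular. -/
theorem exists_height_eq_one_and_not_isRegularLocalRing [CharZero K] (hm : ∀ l, 0 < m l)
    (h : m i ≠ m j) : ∃ (q : Ideal (coeffAlgebra K m)) (_ : q.IsPrime), q.height = 1 ∧
      ¬ IsRegularLocalRing (Localization.AtPrime q) := by
  have hij : i ≠ j := fun e => h (e ▸ rfl)
  let A := coeffAlgebra K m
  let R := MvPolynomial ι K
  let B := MvPolynomial {l // l ≠ j} K
  let π : R →+* B := identify K hij
  have : Algebra.IsIntegral A R := isIntegral_coeffAlgebra hm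
  let q : Ideal A := RingHom.ker (π.comp (algebraMap A R))
  have hq : q.IsPrime := RingHom.ker_isPrime _
  -- A nonzero ideal of a domain contracts to a nonzero ideal along an integral extension, and the
  -- kernel upstairs contains `X i - X j`.
  have hq0 : q ≠ ⊥ := by
    have hne : RingHom.ker π ≠ ⊥ := by
      intro h0
      have h1 : (MvPolynomial.X i - MvPolynomial.X j : R) ∈ RingHom.ker π := by
        rw [RingHom.mem_ker, map_sub, sub_eq_zero]
        exact (identify_X_eq K hij).symm
      rw [h0, Ideal.mem_bot, sub_eq_zero] at h1
      exact hij (MvPolynomial.X_injective h1)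
    exact Ideal.IsIntegral.comap_ne_bot A hne
  have hcard : Nat.card ι = Nat.card {l // l ≠ j} + 1 := by
    rw [Nat.card_eq_fintype_card, Nat.card_eq_fintype_card, Fintype.card_subtype_compl,
      Fintype.card_subtype_eq]
    have : 0 < Fintype.card ι := Fintype.card_pos_iff.2 ⟨j⟩
    omega
  have hle : q.height ≤ 1 := by
    refine height_comap_ker_le_one π (identify_surjective K hij) (n := Nat.card {l // l ≠ j}) ?_ ?_
    · rw [MvPolynomial.ringKrullDim_of_isNoetherianRing, ringKrullDim_eq_zero_of_field, zero_add,
        hcard]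
    · rw [MvPolynomial.ringKrullDim_of_isNoetherianRing, ringKrullDim_eq_zero_of_field, zero_add]
  have hht : q.height = 1 := by
    refine le_antisymm hle (Order.one_le_iff_ne_zero.2 ?_)
    rwa [Ne, Ideal.height_eq_zero_iff_eq_bot]
  refine ⟨q, hq, hht, fun hreg => ?_⟩
  have hic : IsIntegrallyClosed (Localization.AtPrime q) := by
    refine isIntegrallyClosed_of_ringKrullDim_eq_one _ ?_
    rw [IsLocalization.AtPrime.ringKrullDim_eq_height q, hht]
    rfl
  obtain ⟨s, hs, hs0, hsb⟩ := exists_mul_sum_mem_coeffAlgebra (K := K) hm (m i)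
  -- Regularity would put the sum of the roots of multiplicity `m i` into the localization at `q`,
  -- with a denominator `s'` outside `q`.
  obtain ⟨s', hs', a', ha'⟩ := exists_notMem_mul_mem_of_isIntegrallyClosed q
    (Localization.AtPrime q) (Algebra.IsIntegral.isIntegral
      (∑ l with m l = m i, (MvPolynomial.X l : R))) (s := ⟨s, hs⟩) (a := ⟨_, hsb⟩)
    (fun h0 => hs0 (congrArg Subtype.val h0)) rfl
  have hsum : deform K m hij (∑ l with m l = m i, (MvPolynomial.X l : R)) =
      TrivSqZeroExt.inl (identify K hij (∑ l with m l = m i, (MvPolynomial.X l : R))) +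
        TrivSqZeroExt.inr (m j : B) := by
    have hd : ∀ l, deform K m hij (MvPolynomial.X l) =
      TrivSqZeroExt.inl (identify K hij (MvPolynomial.X l)) +
      TrivSqZeroExt.inr (if l = i then (m j : B) else if l = j then -(m i : B) else 0) :=
      fun l => MvPolynomial.aeval_X _ _
    rw [map_sum, map_sum]
    simp only [hd]
    rw [Finset.sum_add_distrib, ← TrivSqZeroExt.inl_sum, ← TrivSqZeroExt.inr_sum]
    congr 2
    -- The index `j` does not occur in the sum, as `m j ≠ m i`; only `i` contributes an `ε`-term.
    rw [Finset.sum_eq_single i]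
    · simp
    · intro l hl hli
      have hlj : l ≠ j := fun e => h ((e ▸ (Finset.mem_filter.1 hl).2 : m j = m i).symm)
      simp [hli, hlj]
    · simp
  have h1 := deform_eq_of_mem_coeffAlgebra K hij a'.2
  have h2 : (a' : R) = s' * ∑ l with m l = m i, (MvPolynomial.X l : R) := ha'.symm
  rw [h2, map_mul, map_mul, hsum, deform_eq_of_mem_coeffAlgebra K hij s'.2, mul_add,
    TrivSqZeroExt.inl_mul, add_eq_left] at h1
  -- The `ε`-part reads `identify s' * m j = 0`. Since `m j ≠ 0` in characteristic zero, this forces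
  -- `s'` into `q`.
  have h3 := congrArg TrivSqZeroExt.snd h1
  simp only [TrivSqZeroExt.inl_mul_inr, TrivSqZeroExt.snd_inr, TrivSqZeroExt.snd_zero,
    smul_eq_mul, mul_eq_zero, Nat.cast_eq_zero, (hm j).ne', or_false] at h3
  exact hs' h3

end NonNormal

/-! ### Equal multiplicities: the coefficient algebra is the ring of symmetric polynomials. -/

section EqualMultiplicities

/-- Over a field of characteristic zero, if the `r`-th power of a monic polynomial has coefficients
in a subalgebra, then so does the polynomial. -/
theorem mem_lifts_of_pow_mem_lifts {K R : Type*} [Field K] [CharZero K] [CommRing R] [IsDomain R]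
    [Algebra K R] (A : Subalgebra K R) {g : R[X]} (hg : g.Monic) {r : ℕ} (hr : 0 < r)
    (h : g ^ r ∈ lifts (algebraMap A R)) : g ∈ lifts (algebraMap A R) := by
  have : CharZero R := charZero_of_injective_algebraMap (algebraMap K R).injective
  -- Starting from `X ^ deg g`, the approximation `u` to `g` is corrected one leading term at a
  -- time; each correction removes one monomial from `g - u`.
  suffices H : ∀ N : ℕ, ∀ u ∈ lifts (algebraMap A R), u.Monic → u.natDegree = g.natDegree →
      (g - u).support.card ≤ N → g ∈ lifts (algebraMap A R) by
    exact H _ (X ^ g.natDegree) ((mem_lifts _).2 ⟨X ^ g.natDegree, by simp⟩) (monic_X_pow _)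
      (natDegree_X_pow _) le_rfl
  intro N
  induction N with
  | zero =>
    intro u hu _ _ hN
    have : g - u = 0 := by simpa using hN
    rwa [sub_eq_zero.1 this]
  | succ N ih =>
    intro u hu hum hun hN
    by_cases hv : g - u = 0
    · rwa [sub_eq_zero.1 hv]
    have hdeg : (g - u).degree < u.degree := by
      rw [← degree_neg, neg_sub]
      refine degree_sub_lt_left ?_ hum.ne_zero (by rw [hum, hg])
      rw [degree_eq_natDegree hum.ne_zero, degree_eq_natDegree hg.ne_zero, hun]
    -- `g ^ r - u ^ r = S * (g - u)`, and `S` has leading coefficient `r`, being a sum of `r` monic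
    -- polynomials of equal degree. Dividing by `r` puts the leading coefficient of `g - u` into
    -- `A`.
    let S : R[X] := ∑ i ∈ Finset.range r, g ^ i * u ^ (r - 1 - i)
    have hS : S * (g - u) = g ^ r - u ^ r := (Commute.all g u).geom_sum₂_mul r
    have hSd : ∀ i ∈ Finset.range r, (g ^ i * u ^ (r - 1 - i)).natDegree =
        (r - 1) * g.natDegree := by
      intro i hi
      rw [(hg.pow i).natDegree_mul (hum.pow _), hg.natDegree_pow, hum.natDegree_pow, hun, ← add_mul]
      congr 1
      have := Finset.mem_range.1 hi
      omega
    have hSc : S.coeff ((r - 1) * g.natDegree) = r := by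
      rw [finsetSum_coeff, Finset.sum_congr rfl fun i hi => ?_]
      · rw [Finset.sum_const, Finset.card_range, nsmul_one]
      · rw [← hSd i hi]
        exact (hg.pow i).mul (hum.pow _)
    have hr0 : (r : R) ≠ 0 := Nat.cast_ne_zero.2 hr.ne'
    have hSn : S.natDegree = (r - 1) * g.natDegree :=
      natDegree_eq_of_le_of_coeff_ne_zero
        (natDegree_sum_le_of_forall_le _ _ fun i hi => (hSd i hi).le) (by rwa [hSc])
    have hSl : S.leadingCoeff = r := by rw [leadingCoeff, hSn, hSc]
    have hlc : (r : R) * (g - u).leadingCoeff = (g ^ r - u ^ r).leadingCoeff := by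
      rw [← hS, leadingCoeff_mul, hSl]
    have hmem : (g ^ r - u ^ r).leadingCoeff ∈ A := by
      obtain ⟨a, ha⟩ := (lifts_iff_coeff_lifts _).1
        (Subring.sub_mem (liftsRing (algebraMap A R)) h (Subring.pow_mem (liftsRing (algebraMap A R)) hu r))
        (g ^ r - u ^ r).natDegree
      rw [leadingCoeff, ← ha]
      exact a.2
    have hlcA : (g - u).leadingCoeff ∈ A := by
      have h1 : (g - u).leadingCoeff = (r : K)⁻¹ • (g ^ r - u ^ r).leadingCoeff := by
        rw [eq_inv_smul_iff₀ (Nat.cast_ne_zero.2 hr.ne'), ← hlc, Algebra.smul_def, map_natCast]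
      rw [h1]
      exact A.smul_mem hmem _
    have hlow : (C (g - u).leadingCoeff * X ^ (g - u).natDegree).degree < u.degree :=
      (degree_C_mul_X_pow_le _ _).trans_lt (by rwa [← degree_eq_natDegree hv])
    refine ih (u + C (g - u).leadingCoeff * X ^ (g - u).natDegree) ?_ (hum.add_of_left hlow)
      ?_ ?_
    · refine Subsemiring.add_mem _ hu ((mem_lifts _).2 ⟨C ⟨_, hlcA⟩ * X ^ (g - u).natDegree, ?_⟩)
      simp
    · rw [natDegree_add_eq_left_of_degree_lt hlow, hun]
    · have : g - (u + C (g - u).leadingCoeff * X ^ (g - u).natDegree) = (g - u).eraseLead := by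
        rw [← self_sub_C_mul_X_pow]
        ring
      rw [this]
      have := card_support_eraseLead_add_one hv
      omega

variable {ι : Type*} [Fintype ι] (K : Type*) [Field K] [CharZero K]

/-- The generic polynomial is `g ^ r`, where the coefficients of `g` are the elementary symmetric
polynomials. By `mem_lifts_of_pow_mem_lifts` the coefficients of `g ^ r` generate the same algebra
as those of `g`. -/
theorem coeffAlgebra_const {m : ι → ℕ} {r : ℕ} (hr : 0 < r) (hm : ∀ l, m l = r) :
    coeffAlgebra K m = MvPolynomial.symmetricSubalgebra ι K := by
  let g : (MvPolynomial ι K)[X] := ∏ l, (X + C (MvPolynomial.X l))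
  have hg : g.Monic := monic_prod_of_monic _ _ fun _ _ => monic_X_add_C _
  have hgm : weightedProd m (MvPolynomial.X : ι → MvPolynomial ι K) = g ^ r := by
    simp [weightedProd, hm, g, Finset.prod_pow]
  have hgd : g.natDegree = Fintype.card ι := by
    simp [g, natDegree_prod_of_monic _ _ fun _ _ => monic_X_add_C _]
  have hsymm : ∀ k ≤ Fintype.card ι, MvPolynomial.esymm ι K k = g.coeff (Fintype.card ι - k) := by
    intro k hk
    rw [MvPolynomial.prod_X_add_C_coeff _ _ _ (Nat.sub_le _ _), Nat.sub_sub_self hk]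
  apply le_antisymm
  · have h1 : g ∈ lifts (algebraMap (MvPolynomial.symmetricSubalgebra ι K) (MvPolynomial ι K)) := by
      rw [lifts_iff_coeff_lifts]
      intro k
      by_cases hk : k ≤ Fintype.card ι
      · refine ⟨⟨MvPolynomial.esymm ι K (Fintype.card ι - k),
          MvPolynomial.esymm_isSymmetric _ _ _⟩, ?_⟩
        exact (MvPolynomial.prod_X_add_C_coeff _ _ _ hk).symm
      · refine ⟨0, ?_⟩
        rw [map_zero, coeff_eq_zero_of_natDegree_lt]
        omega
    refine Algebra.adjoin_le ?_
    rintro _ ⟨k, rfl⟩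
    rw [hgm]
    obtain ⟨a, ha⟩ := (lifts_iff_coeff_lifts _).1 (Subsemiring.pow_mem _ h1 r) k
    rw [← ha]
    exact a.2
  · have h1 : g ∈ lifts (algebraMap (coeffAlgebra K m) (MvPolynomial ι K)) := by
      refine mem_lifts_of_pow_mem_lifts _ hg hr ?_
      rw [← hgm, lifts_iff_coeff_lifts]
      exact fun k => ⟨⟨_, coeff_mem_coeffAlgebra K m k⟩, rfl⟩
    intro p hp
    obtain ⟨Q, hQ⟩ := (MvPolynomial.esymmAlgEquiv ι K rfl).surjective ⟨p, hp⟩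
    have hQ' : p = MvPolynomial.aeval
        (fun i : Fin (Fintype.card ι) => MvPolynomial.esymm ι K (i + 1)) Q := by
      have := congrArg Subtype.val hQ
      rw [← MvPolynomial.esymmAlgHom_apply]
      exact this.symm
    rw [hQ']
    have hle : Algebra.adjoin K (Set.range
        fun i : Fin (Fintype.card ι) => MvPolynomial.esymm ι K (i + 1)) ≤ coeffAlgebra K m := by
      refine Algebra.adjoin_le ?_
      rintro _ ⟨i, rfl⟩
      dsimp only
      rw [hsymm _ i.2]
      obtain ⟨a, ha⟩ := (lifts_iff_coeff_lifts _).1 h1 (Fintype.card ι - (i + 1))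
      rw [← ha]
      exact a.2
    refine hle ?_
    rw [Algebra.adjoin_range_eq_range_aeval]
    exact ⟨Q, rfl⟩

/-- If all multiplicities are equal, then the coefficient algebra is a polynomial ring. -/
def coeffAlgebraEquiv {m : ι → ℕ} {r : ℕ} (hr : 0 < r) (hm : ∀ l, m l = r) :
    MvPolynomial (Fin (Fintype.card ι)) K ≃ₐ[K] coeffAlgebra K m :=
  (MvPolynomial.esymmAlgEquiv ι K rfl).trans
    (Subalgebra.equivOfEq _ _ (coeffAlgebra_const K hr hm).symm)

end EqualMultiplicities

/-! ### The generic polynomial normalized at a point `c`. -/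

section ChartPoly

variable {ι : Type*} [Fintype ι]

/-- The polynomial `∏ l, (1 + t l * (Y - c)) ^ m l`, which takes the value `1` at `c`. -/
def chartPoly {R : Type*} [CommRing R] (m : ι → ℕ) (c : R) (t : ι → R) : R[X] :=
  ∏ l, (1 + C (t l) * (X - C c)) ^ m l

theorem chartPoly_natDegree_le {R : Type*} [CommRing R] (m : ι → ℕ) (c : R) (t : ι → R) :
    (chartPoly m c t).natDegree ≤ ∑ l, m l := by
  refine (natDegree_prod_le _ _).trans (Finset.sum_le_sum fun l _ => ?_)
  refine natDegree_pow_le.trans ?_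
  have : (1 + C (t l) * (X - C c)).natDegree ≤ 1 := by compute_degree
  nlinarith

theorem chartPoly_eval {R : Type*} [CommRing R] (m : ι → ℕ) (c : R) (t : ι → R) :
    (chartPoly m c t).eval c = 1 := by
  simp [chartPoly, eval_prod]

theorem chartPoly_map {R S : Type*} [CommRing R] [CommRing S] (f : R →+* S) (m : ι → ℕ)
    (c : R) (t : ι → R) : (chartPoly m c t).map f = chartPoly m (f c) (fun l => f (t l)) := by
  simp [chartPoly, Polynomial.map_prod]

theorem chartPoly_comp {R : Type*} [CommRing R] (m : ι → ℕ) (c c' : R) (t : ι → R) :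
    (chartPoly m c t).comp (X - C c') = chartPoly m (c + c') t := by
  rw [chartPoly, Polynomial.prod_comp, chartPoly]
  refine Finset.prod_congr rfl fun l _ => ?_
  simp only [pow_comp, add_comp, one_comp, mul_comp, C_comp, sub_comp, X_comp, C_add]
  ring

theorem reflect_pow {R : Type*} [CommRing R] (p : R[X]) {N : ℕ} (hp : p.natDegree ≤ N) (k : ℕ) :
    reflect (k * N) (p ^ k) = reflect N p ^ k := by
  induction k with
  | zero => simp
  | succ k ih =>
    rw [pow_succ, add_mul, one_mul, reflect_mul _ _ _ hp, ih, pow_succ]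
    exact natDegree_pow_le.trans (Nat.mul_le_mul_left k hp)

theorem reflect_prod {R α : Type*} [CommRing R] (s : Finset α) (p : α → R[X]) (N : α → ℕ)
    (h : ∀ a ∈ s, (p a).natDegree ≤ N a) :
    reflect (∑ a ∈ s, N a) (∏ a ∈ s, p a) = ∏ a ∈ s, reflect (N a) (p a) := by
  classical
  induction s using Finset.induction_on with
  | empty => simp
  | insert a s ha ih =>
    have hs : ∀ b ∈ s, (p b).natDegree ≤ N b := fun b hb => h b (Finset.mem_insert_of_mem hb)
    rw [Finset.prod_insert ha, Finset.sum_insert ha, Finset.prod_insert ha,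
      reflect_mul _ _ (h a (Finset.mem_insert_self a s))
        ((natDegree_prod_le _ _).trans (Finset.sum_le_sum hs)), ih hs]

theorem reflect_weightedProd {R : Type*} [CommRing R] (m : ι → ℕ) (t : ι → R) :
    reflect (∑ l, m l) (weightedProd m t) = chartPoly m 0 t := by
  have h1 : ∀ l, (X + C (t l)).natDegree ≤ 1 := fun l => by compute_degree
  have h2 : ∀ l, reflect 1 (X + C (t l)) = 1 + C (t l) * X := fun l => by
    rw [reflect_add, reflect_C, reflect_one_X, pow_one]
  rw [weightedProd, reflect_prod _ _ _ fun l _ => (natDegree_pow_le_of_le _ (h1 l)).trans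
    (mul_one _).le, chartPoly]
  refine Finset.prod_congr rfl fun l _ => ?_
  have := reflect_pow _ (h1 l) (m l)
  rw [mul_one, h2] at this
  rw [this, C_0, sub_zero]

theorem comp_mem_lifts {R S : Type*} [CommRing R] [CommRing S] {f : R →+* S} {p q : S[X]}
    (hp : p ∈ lifts f) (hq : q ∈ lifts f) : p.comp q ∈ lifts f := by
  obtain ⟨p, rfl⟩ := (mem_lifts _).1 hp
  obtain ⟨q, rfl⟩ := (mem_lifts _).1 hq
  exact (mem_lifts _).2 ⟨p.comp q, Polynomial.map_comp _ _ _⟩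

theorem reflect_mem_lifts {R S : Type*} [CommRing R] [CommRing S] {f : R →+* S} {p : S[X]}
    (hp : p ∈ lifts f) (N : ℕ) : reflect N p ∈ lifts f := by
  rw [lifts_iff_coeff_lifts] at hp ⊢
  intro k
  rw [coeff_reflect]
  exact hp _

variable (K : Type*) [Field K] (m : ι → ℕ) (c : K)

/-- The substitution of the coefficients of the generic `chartPoly` for the homogeneous
coordinates. -/
def chartHom (d : ℕ) : MvPolynomial (Fin (d + 1)) K →ₐ[K] MvPolynomial ι K :=
  MvPolynomial.aeval fun j : Fin (d + 1) =>
    (chartPoly m (MvPolynomial.C c) (MvPolynomial.X : ι → MvPolynomial ι K)).coeff j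

/-- Reversal and translation by a constant of `K` carry `weightedProd` to `chartPoly` and back, and
both keep the coefficients inside a given subalgebra. In particular the range does not depend on
`c`. -/
theorem chartHom_range {d : ℕ} (hd : ∑ l, m l = d) :
    (chartHom K m c d).range = coeffAlgebra K m := by
  let R := MvPolynomial ι K
  have hlift : ∀ (A : Subalgebra K R) (a : K),
      (X - C (MvPolynomial.C a) : R[X]) ∈ lifts (algebraMap A R) := fun A a =>
    (mem_lifts _).2 ⟨X - C (algebraMap K A a), by simp; rfl⟩
  rw [chartHom, ← Algebra.adjoin_range_eq_range_aeval]
  apply le_antisymm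
  · refine Algebra.adjoin_le ?_
    rintro _ ⟨j, rfl⟩
    have h1 : weightedProd m (MvPolynomial.X : ι → R) ∈
        lifts (algebraMap (coeffAlgebra K m) R) :=
      (lifts_iff_coeff_lifts _).2 fun k => ⟨⟨_, coeff_mem_coeffAlgebra K m k⟩, rfl⟩
    have h2 := comp_mem_lifts (reflect_mem_lifts h1 (∑ l, m l)) (hlift _ c)
    rw [reflect_weightedProd, chartPoly_comp, zero_add] at h2
    obtain ⟨a, ha⟩ := (lifts_iff_coeff_lifts _).1 h2 j
    dsimp only
    rw [← ha]
    exact a.2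
  · set B := Algebra.adjoin K (Set.range fun j : Fin (d + 1) =>
      (chartPoly m (MvPolynomial.C c) (MvPolynomial.X : ι → R)).coeff j)
    have h1 : chartPoly m (MvPolynomial.C c) (MvPolynomial.X : ι → R) ∈
        lifts (algebraMap B R) := by
      rw [lifts_iff_coeff_lifts]
      intro k
      by_cases hk : k < d + 1
      · exact ⟨⟨_, Algebra.subset_adjoin ⟨⟨k, hk⟩, rfl⟩⟩, rfl⟩
      · refine ⟨0, ?_⟩
        rw [map_zero, coeff_eq_zero_of_natDegree_lt]
        have := chartPoly_natDegree_le m (MvPolynomial.C c) (MvPolynomial.X : ι → R)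
        omega
    have h2 := reflect_mem_lifts (comp_mem_lifts h1 (hlift B (-c))) (∑ l, m l)
    rw [chartPoly_comp, ← map_add, add_neg_cancel, map_zero, ← reflect_weightedProd] at h2
    refine Algebra.adjoin_le ?_
    rintro _ ⟨k, rfl⟩
    obtain ⟨a, ha⟩ := (lifts_iff_coeff_lifts _).1 h2 k
    rw [coeff_reflect, coeff_reflect, revAt_invol] at ha
    rw [← ha]
    exact a.2

theorem eval_chartHom {d : ℕ} (t : ι → K) (P : MvPolynomial (Fin (d + 1)) K) :
    MvPolynomial.eval t (chartHom K m c d P) =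
      MvPolynomial.eval (fun j : Fin (d + 1) => (chartPoly m c t).coeff j) P := by
  have h : (MvPolynomial.aeval t).comp (chartHom K m c d) =
      MvPolynomial.aeval fun j : Fin (d + 1) => (chartPoly m c t).coeff j := by
    refine MvPolynomial.algHom_ext fun j => ?_
    rw [AlgHom.comp_apply, chartHom, MvPolynomial.aeval_X, MvPolynomial.aeval_X]
    have := chartPoly_map (MvPolynomial.aeval t : MvPolynomial ι K →ₐ[K] K).toRingHom m
      (MvPolynomial.C c) MvPolynomial.X
    simp only [AlgHom.toRingHom_eq_coe, RingHom.coe_coe, MvPolynomial.aeval_X,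
      MvPolynomial.aeval_C, Algebra.algebraMap_self, RingHom.id_apply] at this
    rw [← this, coeff_map]
    rfl
  exact DFunLike.congr_fun h P

/-- The linear form on `ℙ(Sym^d V)` which evaluates a binary form at `(1, c)`. -/
def evalForm (d : ℕ) : MvPolynomial (Fin (d + 1)) K :=
  ∑ j : Fin (d + 1), MvPolynomial.C (c ^ (j : ℕ)) * MvPolynomial.X j

theorem evalForm_isHomogeneous (d : ℕ) : (evalForm K c d).IsHomogeneous 1 :=
  MvPolynomial.IsHomogeneous.sum _ _ _ fun j _ => by
    simpa using (MvPolynomial.isHomogeneous_C _ (c ^ (j : ℕ))).mul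
      (MvPolynomial.isHomogeneous_X K j)

theorem aeval_evalForm {S : Type*} [CommRing S] [Algebra K S] {d : ℕ} {p : S[X]}
    (hp : p.natDegree ≤ d) :
    MvPolynomial.aeval (fun j : Fin (d + 1) => p.coeff j) (evalForm K c d) =
      p.eval (algebraMap K S c) := by
  rw [eval_eq_sum_range' (Nat.lt_succ_of_le hp), evalForm, map_sum, Finset.sum_range]
  refine Finset.sum_congr rfl fun j _ => ?_
  simp [mul_comm]

theorem chartHom_evalForm {d : ℕ} (hd : ∑ l, m l = d) :
    chartHom K m c d (evalForm K c d) = 1 := by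
  rw [chartHom, aeval_evalForm K c ((chartPoly_natDegree_le _ _ _).trans hd.le)]
  exact chartPoly_eval _ _ _

/-- A polynomial of degree at most `e` over an algebraically closed field that does not vanish at
`c` is a multiple of a product of `e` affine functions with value `1` at `c`. -/
theorem exists_eq_mul_prod [IsAlgClosed K] (e : ℕ) : ∀ g : K[X], g.natDegree ≤ e → g.eval c ≠ 0 →
    ∃ t : Fin e → K, g = C (g.eval c) * ∏ i, (1 + C (t i) * (X - C c)) := by
  induction e with
  | zero =>
    intro g hg _
    obtain ⟨a, rfl⟩ := natDegree_eq_zero.1 (Nat.le_zero.1 hg)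
    exact ⟨fun _ => 0, by simp⟩
  | succ e ih =>
    intro g hg hgc
    by_cases hge : g.natDegree ≤ e
    · obtain ⟨t, ht⟩ := ih g hge hgc
      -- The parameter `0` stands for a root at infinity.
      refine ⟨Fin.cons 0 t, ?_⟩
      rw [Fin.prod_univ_succ]
      simpa using ht
    · obtain ⟨x, hx⟩ := IsAlgClosed.exists_root g (fun h0 => by
        have : g.natDegree = 0 := natDegree_eq_of_degree_eq_some h0
        omega)
      obtain ⟨h, rfl⟩ := dvd_iff_isRoot.2 hx
      have hcx : c - x ≠ 0 := by
        rintro h0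
        simp [h0] at hgc
      have hhc : h.eval c ≠ 0 := by
        intro h0
        simp [h0] at hgc
      have hh0 : h ≠ 0 := by
        rintro rfl
        simp at hhc
      have hhd : h.natDegree ≤ e := by
        rw [natDegree_mul (X_sub_C_ne_zero x) hh0, natDegree_X_sub_C] at hg
        omega
      obtain ⟨t, ht⟩ := ih h hhd hhc
      -- A finite root `x` has parameter `1 / (c - x)`, since `Y - x = (c - x) (1 + (Y - c) / (c -
      -- x))`.
      refine ⟨Fin.cons (c - x)⁻¹ t, ?_⟩
      rw [Fin.prod_univ_succ]
      simp only [Fin.cons_zero, Fin.cons_succ, eval_mul, eval_sub, eval_X, eval_C, C_mul]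
      have hC : C (c - x) * C (c - x)⁻¹ = (1 : K[X]) := by
        rw [← C_mul, mul_inv_cancel₀ hcx, C_1]
      have hXx : X - C x = C (c - x) * (1 + C (c - x)⁻¹ * (X - C c)) := by
        rw [mul_add, ← mul_assoc, hC, C_sub]
        ring
      conv_lhs => rw [ht, hXx]
      ring

end ChartPoly

/-! ### Binary forms and the equations of the locus. -/

section Forms

variable {K : Type u} [Field K]

/-- The dehomogenization `F(x, y) ↦ F(1, Y)`. -/
def dehomogenize (K : Type u) [Field K] : MvPolynomial (Fin 2) K →ₐ[K] K[X] :=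
  MvPolynomial.aeval ![1, X]

theorem coeff_dehomogenize (F : MvPolynomial (Fin 2) K) (j : ℕ) :
    (dehomogenize K F).coeff j =
      ∑ s ∈ F.support, if s 1 = j then MvPolynomial.coeff s F else 0 := by
  conv_lhs => rw [F.as_sum, map_sum, finsetSum_coeff]
  refine Finset.sum_congr rfl fun s _ => ?_
  rw [dehomogenize, MvPolynomial.aeval_monomial, Finsupp.prod_fintype _ _ (by simp)]
  simp [coeff_X_pow, eq_comm]

theorem coeffs_eq_coeff_dehomogenize {n : ℕ} (F : BinaryForm K n) (j : Fin (n + 1)) :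
    coeffs F j = (dehomogenize K F.1).coeff j := by
  have hF : F.1.IsHomogeneous n := F.2
  have hj : (j : ℕ) ≤ n := Nat.lt_succ_iff.1 j.2
  rw [coeff_dehomogenize, coeffs]
  set s₀ : Fin 2 →₀ ℕ := Finsupp.single 0 (n - j) + Finsupp.single 1 (j : ℕ)
  rw [Finset.sum_eq_single s₀]
  · simp [s₀]
  · intro s hs hne
    rw [if_neg]
    intro hsj
    refine hne (Finsupp.ext fun k => ?_)
    have hdeg := hF (MvPolynomial.mem_support_iff.1 hs)
    have hsum : s 0 + s 1 = n := by
      rw [← hdeg, Finsupp.weight_apply, Finsupp.sum_fintype _ _ (by simp)]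
      simp
    fin_cases k
    · simp [s₀]
      omega
    · simp [s₀, hsj]
  · intro hs
    rw [MvPolynomial.notMem_support_iff.1 hs, ite_self]

theorem natDegree_dehomogenize_le {n : ℕ} (F : BinaryForm K n) :
    (dehomogenize K F.1).natDegree ≤ n := by
  have hF : F.1.IsHomogeneous n := F.2
  rw [natDegree_le_iff_coeff_eq_zero]
  intro j hj
  rw [coeff_dehomogenize]
  refine Finset.sum_eq_zero fun s hs => if_neg ?_
  have hdeg := hF (MvPolynomial.mem_support_iff.1 hs)
  have hsum : s 0 + s 1 = n := by
    rw [← hdeg, Finsupp.weight_apply, Finsupp.sum_fintype _ _ (by simp)]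
    simp
  omega

theorem coeffs_smul {n : ℕ} (a : K) (F : BinaryForm K n) : coeffs (a • F) = a • coeffs F := by
  funext j
  simp [coeffs]

theorem eval_smul_of_isHomogeneous {σ : Type*} {P : MvPolynomial σ K} {n : ℕ}
    (hP : P.IsHomogeneous n) (a : K) (v : σ → K) :
    MvPolynomial.eval (a • v) P = a ^ n * MvPolynomial.eval v P := by
  rw [MvPolynomial.eval_eq, MvPolynomial.eval_eq, Finset.mul_sum]
  refine Finset.sum_congr rfl fun s hs => ?_
  have hs' := hP.degree_eq_sum_deg_support hs
  simp only [Pi.smul_apply, smul_eq_mul, mul_pow, Finset.prod_mul_distrib]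
  rw [Finset.prod_pow_eq_pow_sum, hs']
  ring

theorem dehomogenize_prodForm {d : ℕ} (lam : d.Partition)
    (G : (r : Fin d) → BinaryForm K (mult lam ((r : ℕ) + 1))) :
    dehomogenize K (prodForm lam G).1 = ∏ r : Fin d, dehomogenize K (G r).1 ^ ((r : ℕ) + 1) := by
  rw [prodForm, map_prod]
  simp only [map_pow]

/-- The binary form `∏ i, (x + t i * (y - c * x))`. -/
def linearProd (c : K) {e : ℕ} (t : Fin e → K) : BinaryForm K e :=
  ⟨∏ i, (MvPolynomial.X 0 + MvPolynomial.C (t i) *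
    (MvPolynomial.X 1 - MvPolynomial.C c * MvPolynomial.X 0)), by
    have h : ∀ a : K, ∀ i : Fin 2, (MvPolynomial.C a * MvPolynomial.X i).IsHomogeneous 1 :=
      MvPolynomial.isHomogeneous_C_mul_X
    have := MvPolynomial.IsHomogeneous.prod (Finset.univ : Finset (Fin e))
      (fun i => MvPolynomial.X 0 + MvPolynomial.C (t i) *
        (MvPolynomial.X 1 - MvPolynomial.C c * MvPolynomial.X 0)) (fun _ => 1)
      fun i _ => (MvPolynomial.isHomogeneous_X K 0).add
        (((MvPolynomial.isHomogeneous_X K 1).sub (h c 0)).C_mul (t i))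
    simpa using this⟩

theorem dehomogenize_linearProd (c : K) {e : ℕ} (t : Fin e → K) :
    dehomogenize K (linearProd c t).1 = ∏ i, (1 + C (t i) * (X - C c)) := by
  rw [linearProd, map_prod]
  refine Finset.prod_congr rfl fun i _ => ?_
  simp [dehomogenize]

theorem linearProd_ne_zero (c : K) {e : ℕ} (t : Fin e → K) : linearProd c t ≠ 0 := by
  intro h
  have h1 := congrArg (fun F : BinaryForm K e => (dehomogenize K F.1).eval c) h
  simp [dehomogenize_linearProd, eval_prod] at h1

/-- The parts of a partition. -/
abbrev Parts {d : ℕ} (lam : d.Partition) : Type :=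
  Σ r : Fin d, Fin (mult lam ((r : ℕ) + 1))

/-- The size of a part. -/
def Parts.size {d : ℕ} {lam : d.Partition} (l : Parts lam) : ℕ := (l.1 : ℕ) + 1

theorem sum_size {d : ℕ} (lam : d.Partition) : ∑ l : Parts lam, l.size = d := by
  rw [Fintype.sum_sigma]
  simpa [Parts.size] using sum_mult lam

theorem chartPoly_size {d : ℕ} (lam : d.Partition) (c : K) (t : Parts lam → K) :
    chartPoly Parts.size c t =
      ∏ r : Fin d, (∏ i, (1 + C (t ⟨r, i⟩) * (X - C c))) ^ ((r : ℕ) + 1) := by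
  rw [chartPoly, Fintype.prod_sigma]
  simp only [Parts.size, Finset.prod_pow]

/-- A representative of `mk v` is a multiple of `v`. -/
theorem exists_coeffs_rep_eq {n : ℕ} (F : BinaryForm K n) (hF : F ≠ 0) :
    ∃ a : K, a ≠ 0 ∧ coeffs (Projectivization.mk K F hF).rep = a • coeffs F := by
  obtain ⟨a, ha⟩ := Projectivization.exists_smul_eq_mk_rep K F hF
  refine ⟨a, a.ne_zero, ?_⟩
  rw [← ha, ← coeffs_smul]
  rfl

/-- At every parameter value `t` the generic polynomial comes from a point of the image of `f_λ`, so
`chartHom P` vanishes as a function; over an infinite field it is then zero. -/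
theorem chartHom_eq_zero_of_mem_vanishingPolys [Infinite K] {d : ℕ} (lam : d.Partition) (c : K)
    {P : MvPolynomial (Fin (d + 1)) K} (hP : P ∈ vanishingPolys K lam) :
    chartHom K (Parts.size (lam := lam)) c d P = 0 := by
  obtain ⟨⟨n, hn⟩, hv⟩ := hP
  refine MvPolynomial.funext fun t => ?_
  rw [eval_chartHom, map_zero]
  let G : (r : Fin d) → BinaryForm K (mult lam ((r : ℕ) + 1)) :=
    fun r => linearProd c fun i => t ⟨r, i⟩
  have hG : ∀ r, G r ≠ 0 := fun r => linearProd_ne_zero _ _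
  have h1 := hv _ ⟨fun r => Projectivization.mk K (G r) (hG r), rfl⟩
  rw [multMap_mk] at h1
  obtain ⟨a, ha, hrep⟩ := exists_coeffs_rep_eq (prodForm lam G) (prodForm_ne_zero lam G hG)
  rw [hrep, eval_smul_of_isHomogeneous hn, mul_eq_zero, or_iff_right (pow_ne_zero _ ha)] at h1
  rw [← h1]
  congr 2
  funext j
  rw [coeffs_eq_coeff_dehomogenize, dehomogenize_prodForm, chartPoly_size]
  simp only [G, dehomogenize_linearProd]

/-- Partial converse: `P` vanishes at the image points inside the chart, because their forms split
into the factors parametrized by `t`. The factor `evalForm` takes care of the points outside the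
chart. -/
theorem mul_evalForm_mem_vanishingPolys [IsAlgClosed K] {d : ℕ} (lam : d.Partition) (c : K)
    {P : MvPolynomial (Fin (d + 1)) K} {n : ℕ} (hn : P.IsHomogeneous n)
    (hP : chartHom K (Parts.size (lam := lam)) c d P = 0) :
    P * evalForm K c d ∈ vanishingPolys K lam := by
  refine ⟨⟨n + 1, hn.mul (evalForm_isHomogeneous K c d)⟩, ?_⟩
  rintro _ ⟨p, rfl⟩
  let G := fun r => (p r).rep
  obtain ⟨a, ha, hrep⟩ := exists_coeffs_rep_eq (prodForm lam G)
    (prodForm_ne_zero lam G fun r => (p r).rep_nonzero)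
  have hrep' : coeffs (multMap K lam p).rep = a • coeffs (prodForm lam G) := hrep
  rw [hrep', eval_smul_of_isHomogeneous (hn.mul (evalForm_isHomogeneous K c d)), map_mul]
  have hcoeffs : coeffs (prodForm lam G) =
      fun j : Fin (d + 1) => (dehomogenize K (prodForm lam G).1).coeff j :=
    funext fun j => coeffs_eq_coeff_dehomogenize _ j
  by_cases h0 : (dehomogenize K (prodForm lam G).1).eval c = 0
  · have h1 := aeval_evalForm K c (natDegree_dehomogenize_le (prodForm lam G))
    rw [← hcoeffs] at h1
    have h2 : MvPolynomial.eval (coeffs (prodForm lam G)) (evalForm K c d) = 0 := h1.trans h0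
    rw [h2, mul_zero, mul_zero]
  · rw [dehomogenize_prodForm, eval_prod, Finset.prod_eq_zero_iff] at h0
    have hne : ∀ r, (dehomogenize K (G r).1).eval c ≠ 0 := by
      intro r hr
      exact h0 ⟨r, Finset.mem_univ r, by simp [hr]⟩
    choose t ht using fun r => exists_eq_mul_prod K c _ _ (natDegree_dehomogenize_le (G r)) (hne r)
    let b : K := ∏ r : Fin d, (dehomogenize K (G r).1).eval c ^ ((r : ℕ) + 1)
    have hb : dehomogenize K (prodForm lam G).1 =
        C b * chartPoly Parts.size c fun l : Parts lam => t l.1 l.2 := by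
      rw [dehomogenize_prodForm, chartPoly_size, map_prod, ← Finset.prod_mul_distrib]
      refine Finset.prod_congr rfl fun r _ => ?_
      conv_lhs => rw [ht r]
      rw [mul_pow, C_pow]
    have hc : coeffs (prodForm lam G) = b • fun j : Fin (d + 1) =>
        (chartPoly Parts.size c fun l : Parts lam => t l.1 l.2).coeff j := by
      rw [hcoeffs, hb]
      funext j
      simp
    rw [hc, eval_smul_of_isHomogeneous hn, ← eval_chartHom, hP]
    simp

end Forms

/-! ### The locus on the standard charts of projective space. -/

section Charts

attribute [local instance] MvPolynomial.gradedAlgebra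

variable (K : Type u) [Field K] {d : ℕ} (lam : d.Partition) (c : K)

/-- The grading of the homogeneous coordinate ring of `ℙ^d`. -/
abbrev coordGrading (K : Type u) [Field K] (d : ℕ) : ℕ → Submodule K (MvPolynomial (Fin (d + 1)) K) :=
  MvPolynomial.homogeneousSubmodule (Fin (d + 1)) K

theorem evalForm_mem : evalForm K c d ∈ coordGrading K d 1 := evalForm_isHomogeneous K c d

/-- The points of `X_λ` in the chart where the form does not vanish at `(1, c)`, parametrized by
roots. -/
def chartAwayHom : HomogeneousLocalization.Away (coordGrading K d) (evalForm K c d) →+*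
    MvPolynomial (Parts lam) K :=
  (Localization.awayLift (chartHom K (Parts.size (lam := lam)) c d).toRingHom (evalForm K c d)
    (by
      rw [AlgHom.toRingHom_eq_coe, RingHom.coe_coe, chartHom_evalForm K _ c (sum_size lam)]
      exact isUnit_one)).comp (algebraMap _ _)

/-- The function `P / ℓ ^ n` on the chart `ℓ = evalForm K c d ≠ 0`. -/
def chartFrac {n : ℕ} {P : MvPolynomial (Fin (d + 1)) K} (hP : P.IsHomogeneous n) :
    HomogeneousLocalization.Away (coordGrading K d) (evalForm K c d) :=
  HomogeneousLocalization.Away.mk _ (evalForm_mem K c) n P (by rwa [smul_eq_mul, mul_one])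

theorem chartFrac_val {n : ℕ} {P : MvPolynomial (Fin (d + 1)) K} (hP : P.IsHomogeneous n) :
    (chartFrac K c hP).val =
      Localization.mk P (⟨evalForm K c d ^ n, n, rfl⟩ : Submonoid.powers (evalForm K c d)) := rfl

theorem exists_chartFrac_eq
    (x : HomogeneousLocalization.Away (coordGrading K d) (evalForm K c d)) :
    ∃ (n : ℕ) (P : MvPolynomial (Fin (d + 1)) K) (hP : P.IsHomogeneous n),
      chartFrac K c hP = x := by
  obtain ⟨n, P, hP, rfl⟩ := HomogeneousLocalization.Away.mk_surjective _ (evalForm_mem K c) x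
  exact ⟨n, P, by rwa [smul_eq_mul, mul_one] at hP, rfl⟩

theorem chartAwayHom_chartFrac {n : ℕ} {P : MvPolynomial (Fin (d + 1)) K}
    (hP : P.IsHomogeneous n) : chartAwayHom K lam c (chartFrac K c hP) =
      chartHom K (Parts.size (lam := lam)) c d P := by
  rw [chartAwayHom, RingHom.comp_apply, HomogeneousLocalization.algebraMap_apply,
    chartFrac_val, Localization.awayLift_mk (v := 1)]
  · simp
  · simp [chartHom_evalForm K _ c (sum_size lam)]

theorem chartAwayHom_fromZeroRingHom (a : K) :
    chartAwayHom K lam c (HomogeneousLocalization.fromZeroRingHom (coordGrading K d) _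
      (algebraMap K (coordGrading K d 0) a)) = MvPolynomial.C a := by
  have h2 : HomogeneousLocalization.fromZeroRingHom (coordGrading K d)
      (Submonoid.powers (evalForm K c d)) (algebraMap K (coordGrading K d 0) a) =
      chartFrac K c (MvPolynomial.isHomogeneous_C _ a) := by
    apply HomogeneousLocalization.val_injective
    rw [chartFrac_val]
    simp only [pow_zero]
    rfl
  rw [h2, chartAwayHom_chartFrac]
  exact (chartHom K (Parts.size (lam := lam)) c d).commutes a

theorem mem_range_chartAwayHom (a : MvPolynomial (Parts lam) K) :
    a ∈ (chartAwayHom K lam c).range ↔ a ∈ coeffAlgebra K (Parts.size (lam := lam)) := by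
  constructor
  · rintro ⟨x, rfl⟩
    obtain ⟨n, P, hP, rfl⟩ := exists_chartFrac_eq K c x
    rw [chartAwayHom_chartFrac, ← chartHom_range K _ c (sum_size lam)]
    exact ⟨P, rfl⟩
  · intro ha
    rw [← chartHom_range K _ c (sum_size lam), chartHom,
      ← Algebra.adjoin_range_eq_range_aeval] at ha
    induction ha using Algebra.adjoin_induction with
    | mem x hx =>
      obtain ⟨j, rfl⟩ := hx
      refine ⟨chartFrac K c (MvPolynomial.isHomogeneous_X K j), ?_⟩
      rw [chartAwayHom_chartFrac, chartHom, MvPolynomial.aeval_X]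
    | algebraMap a => exact ⟨_, chartAwayHom_fromZeroRingHom K lam c a⟩
    | add x y _ _ hx hy => exact add_mem hx hy
    | mul x y _ _ hx hy => exact mul_mem hx hy

/-- The open immersion of the chart `D₊(evalForm K c d)` into `ℙ^d`. -/
abbrev chartι : Spec (.of (HomogeneousLocalization.Away (coordGrading K d) (evalForm K c d))) ⟶
    ProjSpace K d :=
  Proj.awayι (coordGrading K d) (evalForm K c d) (evalForm_mem K c) one_pos

/-- This identifies the equations of the locus on the chart with the relations among the
coefficients of the generic product. -/
theorem chartι_mem_closedLocus_iff [IsAlgClosed K]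
    (y : Spec (.of (HomogeneousLocalization.Away (coordGrading K d) (evalForm K c d)))) :
    chartι K c y ∈ closedLocus K lam ↔ RingHom.ker (chartAwayHom K lam c) ≤ y.asIdeal := by
  have hmem : ∀ {n : ℕ} (hn : 0 < n) {P : MvPolynomial (Fin (d + 1)) K}
      (hP : P.IsHomogeneous n), P ∈ (chartι K c y).asHomogeneousIdeal ↔
        chartFrac K c hP ∈ y.asIdeal := by
    intro n hn P hP
    have h := Proj.awayι_preimage_basicOpen (coordGrading K d) (evalForm_mem K c) one_pos hP hn
    have h1 : P ∉ (chartι K c y).asHomogeneousIdeal ↔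
        HomogeneousLocalization.Away.isLocalizationElem (evalForm_mem K c) hP ∉ y.asIdeal :=
      Iff.of_eq (congrArg (fun U : (Spec (.of (HomogeneousLocalization.Away (coordGrading K d)
        (evalForm K c d)))).Opens => y ∈ U) h)
    have h2 : HomogeneousLocalization.Away.isLocalizationElem (evalForm_mem K c) hP =
        chartFrac K c hP := by
      apply HomogeneousLocalization.val_injective
      simp [HomogeneousLocalization.Away.isLocalizationElem, chartFrac_val]
    rw [← h2]
    exact not_iff_not.1 h1
  have hlocus : chartι K c y ∈ closedLocus K lam ↔
      ∀ P ∈ vanishingPolys K lam, P ∈ (chartι K c y).asHomogeneousIdeal := Iff.rfl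
  rw [hlocus]
  constructor
  · intro h x hx
    obtain ⟨n, P, hP, rfl⟩ := exists_chartFrac_eq K c x
    rw [RingHom.mem_ker, chartAwayHom_chartFrac] at hx
    have h1 := (hmem n.succ_pos (hP.mul (evalForm_isHomogeneous K c d))).1
      (h _ (mul_evalForm_mem_vanishingPolys lam c hP hx))
    -- With `ℓ` for `evalForm`, `P / ℓ ^ n = P ℓ / ℓ ^ (n + 1)`, so the extra factor is harmless.
    convert h1 using 1
    apply HomogeneousLocalization.val_injective
    rw [chartFrac_val, chartFrac_val, Localization.mk_eq_mk_iff, Localization.r_iff_exists]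
    refine ⟨1, ?_⟩
    simp only [OneMemClass.coe_one, one_mul, Nat.succ_eq_add_one]
    ring
  · intro h P hP
    have h0 := chartHom_eq_zero_of_mem_vanishingPolys lam c hP
    obtain ⟨⟨n, hn⟩, -⟩ := hP
    -- `hmem` needs positive degree. A constant is fixed by `chartHom`, so in degree zero `P = 0`.
    rcases Nat.eq_zero_or_pos n with rfl | hpos
    · have : P = 0 := by
        rw [← MvPolynomial.totalDegree_zero_iff_isHomogeneous,
          MvPolynomial.totalDegree_eq_zero_iff_eq_C] at hn
        rw [hn] at h0 ⊢
        have h1 : chartHom K (Parts.size (lam := lam)) c d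
          (MvPolynomial.C (MvPolynomial.coeff 0 P)) = MvPolynomial.C (MvPolynomial.coeff 0 P) :=
          (chartHom K (Parts.size (lam := lam)) c d).commutes _
        rw [h1, MvPolynomial.C_eq_zero] at h0
        rw [h0, MvPolynomial.C_0]
      rw [this]
      exact Submodule.zero_mem _
    · rw [hmem hpos hn]
      apply h
      rw [RingHom.mem_ker, chartAwayHom_chartFrac, h0]

/-! ### Affine charts of the reduced closed subscheme and their ideals. -/

/-- The chart `Spec (Γ(X, U) / I(U))` of the closed subscheme of `X` defined by `I`. -/
def subschemeChart {X : Scheme.{u}} (I : X.IdealSheafData) (U : X.affineOpens) :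
    Spec (.of (Γ(X, U.1) ⧸ I.ideal U)) ⟶ I.subscheme :=
  I.subschemeCover.f U

instance isOpenImmersion_subschemeChart {X : Scheme.{u}} (I : X.IdealSheafData)
    (U : X.affineOpens) : IsOpenImmersion (subschemeChart I U) :=
  Scheme.AffineCover.map_prop I.subschemeCover U

theorem subschemeChart_ι {X : Scheme.{u}} (I : X.IdealSheafData) (U : X.affineOpens)
    (hU : IsAffineOpen U.1) : subschemeChart I U ≫ I.subschemeι =
      Spec.map (CommRingCat.ofHom (Ideal.Quotient.mk (I.ideal U))) ≫ hU.fromSpec :=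
  (I.subschemeCover_map_subschemeι U).trans (I.glueDataObjι_ι U)

theorem mem_range_subschemeChart {X : Scheme.{u}} (I : X.IdealSheafData) (U : X.affineOpens)
    (x : I.subscheme) (hx : I.subschemeι x ∈ U.1) : x ∈ Set.range (subschemeChart I U) := by
  have h := I.opensRange_subschemeCover_map U
  have := isOpenImmersion_subschemeChart I U
  have h1 : x ∈ (subschemeChart I U).opensRange := h.symm ▸ hx
  exact h1

/-- The affine open subset of `ℙ^d` where the linear form `evalForm K c d` does not vanish. -/
abbrev chartOpen (K : Type u) [Field K] (d : ℕ) (c : K) : (ProjSpace K d).Opens :=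
  Proj.basicOpen (coordGrading K d) (evalForm K c d)

theorem isAffineOpen_chartOpen : IsAffineOpen (chartOpen K d c) :=
  Proj.isAffineOpen_basicOpen _ _ (evalForm_mem K c) one_pos

/-- `chartOpen` as an affine open subset. -/
abbrev chartAffineOpen (K : Type u) [Field K] (d : ℕ) (c : K) : (ProjSpace K d).affineOpens :=
  ⟨chartOpen K d c, isAffineOpen_chartOpen K c⟩

/-- The isomorphism of the coordinate ring of a chart with the degree zero localization. -/
def chartIso (K : Type u) [Field K] (d : ℕ) (c : K) :
    CommRingCat.of (HomogeneousLocalization.Away (coordGrading K d) (evalForm K c d)) ≅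
      Γ(ProjSpace K d, chartOpen K d c) :=
  Proj.basicOpenIsoAway (coordGrading K d) (evalForm K c d) (evalForm_mem K c) one_pos

theorem chartIso_hom_inv_apply
    (x : HomogeneousLocalization.Away (coordGrading K d) (evalForm K c d)) :
    (chartIso K d c).inv ((chartIso K d c).hom x) = x :=
  CommRingCat.inv_hom_apply (chartIso K d c) x

theorem chartIso_inv_hom_apply (z : Γ(ProjSpace K d, chartOpen K d c)) :
    (chartIso K d c).hom ((chartIso K d c).inv z) = z :=
  CommRingCat.hom_inv_apply (chartIso K d c) z

theorem chartIso_hom_fromSpec :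
    Spec.map (chartIso K d c).hom ≫ chartι K c = (isAffineOpen_chartOpen K c).fromSpec := by
  have h1 : chartι K c = (Proj.basicOpenIsoSpec (coordGrading K d) (evalForm K c d)
      (evalForm_mem K c) one_pos).inv ≫ (chartOpen K d c).ι := rfl
  have h2 : (isAffineOpen_chartOpen K c).isoSpec.hom ≫ Spec.map (chartIso K d c).hom =
      (Proj.basicOpenIsoSpec (coordGrading K d) (evalForm K c d) (evalForm_mem K c) one_pos).hom := by
    rw [Proj.basicOpenIsoSpec_hom]
    rfl
  rw [← cancel_epi (isAffineOpen_chartOpen K c).isoSpec.hom, ← Category.assoc, h2, h1,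
    Iso.hom_inv_id_assoc, IsAffineOpen.isoSpec_hom_fromSpec]

/-- The ideal of `X_λ` on a chart is the kernel of the parametrization by roots. -/
theorem mem_ideal_chartOpen_iff [IsAlgClosed K]
    (x : HomogeneousLocalization.Away (coordGrading K d) (evalForm K c d)) :
    (chartIso K d c).hom x ∈
      (Scheme.IdealSheafData.vanishingIdeal (closedLocus K lam)).ideal (chartAffineOpen K d c) ↔
        chartAwayHom K lam c x = 0 := by
  rw [Scheme.IdealSheafData.vanishingIdeal_ideal, PrimeSpectrum.mem_vanishingIdeal]
  have hmem : ∀ p : Spec Γ(ProjSpace K d, chartOpen K d c),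
      p ∈ (isAffineOpen_chartOpen K c).fromSpec ⁻¹' (closedLocus K lam : Set (ProjSpace K d)) ↔
        RingHom.ker (chartAwayHom K lam c) ≤ (Spec.map (chartIso K d c).hom p).asIdeal := by
    intro p
    rw [← chartι_mem_closedLocus_iff, ← chartIso_hom_fromSpec]
    rfl
  constructor
  · intro h
    -- The kernel is prime, so it is itself a point of the locus (its generic point in the chart); a
    -- function vanishing on the locus lies in it.
    let y : Spec (.of (HomogeneousLocalization.Away (coordGrading K d) (evalForm K c d))) :=
      ⟨RingHom.ker (chartAwayHom K lam c), RingHom.ker_isPrime _⟩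
    let p := Spec.map (chartIso K d c).inv y
    have hp : Spec.map (chartIso K d c).hom p = y := by
      refine PrimeSpectrum.ext (Ideal.ext fun z => ?_)
      change (chartIso K d c).inv ((chartIso K d c).hom z) ∈ y.asIdeal ↔ z ∈ y.asIdeal
      rw [chartIso_hom_inv_apply]
    have h1 := h p ((hmem p).2 (by rw [hp]))
    have h2 : x ∈ (Spec.map (chartIso K d c).hom p).asIdeal := h1
    rw [hp] at h2
    exact h2
  · intro hx p hp
    exact (hmem p).1 hp hx

/-- The restriction of functions on a chart of `ℙ^d` to `X_λ`. -/
def chartRestrict : Γ(ProjSpace K d, chartOpen K d c) →+*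
    coeffAlgebra K (Parts.size (lam := lam)) :=
  ((chartAwayHom K lam c).comp (chartIso K d c).inv.hom).codRestrict
    (coeffAlgebra K (Parts.size (lam := lam))) fun x =>
      (mem_range_chartAwayHom K lam c _).1 ⟨(chartIso K d c).inv.hom x, rfl⟩

theorem chartRestrict_chartIso
    (x : HomogeneousLocalization.Away (coordGrading K d) (evalForm K c d)) :
    (chartRestrict K lam c ((chartIso K d c).hom x) : MvPolynomial (Parts lam) K) =
      chartAwayHom K lam c x := by
  change chartAwayHom K lam c ((chartIso K d c).inv ((chartIso K d c).hom x)) = _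
  rw [chartIso_hom_inv_apply]

theorem chartRestrict_surjective : Function.Surjective (chartRestrict K lam c) := by
  rintro ⟨a, ha⟩
  obtain ⟨x, hx⟩ := (mem_range_chartAwayHom K lam c a).2 ha
  exact ⟨(chartIso K d c).hom x, Subtype.ext ((chartRestrict_chartIso K lam c x).trans hx)⟩

theorem X_mem_of_evalForm_mem [Infinite K] {I : Ideal (MvPolynomial (Fin (d + 1)) K)} [I.IsPrime]
    (hI : ∀ c, evalForm K c d ∈ I) (j : Fin (d + 1)) : MvPolynomial.X j ∈ I := by
  obtain ⟨S, _, _, g, hg⟩ : ∃ (S : Type u) (_ : CommRing S) (_ : IsDomain S)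
      (g : MvPolynomial (Fin (d + 1)) K →+* S), RingHom.ker g = I :=
    ⟨_, _, inferInstance, Ideal.Quotient.mk I, Ideal.mk_ker⟩
  -- The value of `Q` at the image of `c` is the image of `evalForm K c d`, which is zero; with
  -- infinitely many roots in a domain, `Q` and all its coefficients vanish.
  let Q : S[X] := ∑ j : Fin (d + 1), C (g (MvPolynomial.X j)) * X ^ (j : ℕ)
  let f : K →+* S := g.comp MvPolynomial.C
  have hQ : Q = 0 := by
    refine eq_zero_of_infinite_isRoot Q ((Set.infinite_range_of_injective f.injective).mono ?_)
    rintro _ ⟨c, rfl⟩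
    have hc : g (evalForm K c d) = 0 := by
      rw [← RingHom.mem_ker, hg]
      exact hI c
    change Q.eval (f c) = 0
    rw [← hc, evalForm, map_sum, eval_finsetSum]
    refine Finset.sum_congr rfl fun j _ => ?_
    simp only [eval_mul, eval_C, eval_pow, eval_X, map_mul, map_pow, f, RingHom.comp_apply, mul_comm]
  have := congrArg (fun p => p.coeff (j : ℕ)) hQ
  simp only [Q, finsetSum_coeff, coeff_C_mul, coeff_X_pow, coeff_zero, Fin.val_inj, mul_ite,
    mul_one, mul_zero, Finset.sum_ite_eq, Finset.mem_univ, if_true] at this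
  rwa [← hg, RingHom.mem_ker]

theorem irrelevant_le_of_X_mem (I : Ideal (MvPolynomial (Fin (d + 1)) K))
    (hI : ∀ j, MvPolynomial.X j ∈ I) :
    (HomogeneousIdeal.irrelevant (coordGrading K d)).toIdeal ≤ I := by
  intro P hP
  have hP0 : MvPolynomial.coeff 0 P = 0 := by
    have h1 : GradedRing.proj (coordGrading K d) 0 P = 0 := hP
    have h2 : MvPolynomial.homogeneousComponent 0 P = 0 :=
      (MvPolynomial.decomposition.decompose'_apply P 0).symm.trans h1
    rwa [MvPolynomial.homogeneousComponent_zero, MvPolynomial.C_eq_zero] at h2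
  rw [P.as_sum]
  refine Ideal.sum_mem _ fun m hm => ?_
  obtain ⟨j, hj⟩ : ∃ j, m j ≠ 0 := by
    by_contra! h
    obtain rfl : m = 0 := Finsupp.ext h
    exact (MvPolynomial.mem_support_iff.1 hm) hP0
  exact I.mem_of_dvd (MvPolynomial.X_dvd_monomial.2 (Or.inr hj)) (hI j)

/-! ### The cover of the locus by spectra of the coefficient algebra, and its local rings. -/

variable [IsAlgClosed K]

theorem ker_chartRestrict : RingHom.ker (chartRestrict K lam c) =
    (Scheme.IdealSheafData.vanishingIdeal (closedLocus K lam)).ideal (chartAffineOpen K d c) := by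
  ext z
  obtain ⟨x, rfl⟩ : ∃ x, (chartIso K d c).hom x = z := ⟨_, chartIso_inv_hom_apply K c z⟩
  rw [mem_ideal_chartOpen_iff, ← chartRestrict_chartIso, RingHom.mem_ker]
  exact Subtype.ext_iff

/-- The coordinate ring of a chart of `X_λ` is the coefficient algebra. -/
def chartQuotientEquiv : Γ(ProjSpace K d, chartOpen K d c) ⧸
    (Scheme.IdealSheafData.vanishingIdeal (closedLocus K lam)).ideal (chartAffineOpen K d c) ≃+*
      coeffAlgebra K (Parts.size (lam := lam)) :=
  (Ideal.quotEquivOfEq (ker_chartRestrict K lam c).symm).trans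
    (RingHom.quotientKerEquivOfSurjective (chartRestrict_surjective K lam c))

/-- The chart of `X_λ` of the forms that do not vanish at `(1, c)`. -/
def locusChart : Spec (.of (coeffAlgebra K (Parts.size (lam := lam)))) ⟶
    coincidentRootLocus K lam :=
  Spec.map (CommRingCat.ofHom (chartQuotientEquiv K lam c).toRingHom) ≫
    subschemeChart (.vanishingIdeal (closedLocus K lam)) (chartAffineOpen K d c)

instance isIso_chartQuotientEquiv :
    IsIso (Spec.map (CommRingCat.ofHom (chartQuotientEquiv K lam c).toRingHom)) := by
  have : IsIso (CommRingCat.ofHom (chartQuotientEquiv K lam c).toRingHom) :=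
    (chartQuotientEquiv K lam c).toCommRingCatIso.isIso_hom
  infer_instance

instance isOpenImmersion_locusChart : IsOpenImmersion (locusChart K lam c) :=
  @IsOpenImmersion.comp _ _ _ _ _ inferInstance
    (isOpenImmersion_subschemeChart (.vanishingIdeal (closedLocus K lam)) (chartAffineOpen K d c))

/-- `chartQuotientEquiv` is only a ring isomorphism; smoothness over `K` also needs compatibility
with the structure morphisms. -/
theorem locusChart_toSpec : locusChart K lam c ≫ coincidentRootLocus.toSpec K lam =
    Spec.map (CommRingCat.ofHom
      (algebraMap K (coeffAlgebra K (Parts.size (lam := lam))))) := by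
  have h1 : locusChart K lam c ≫ coincidentRootLocus.toSpec K lam =
      Spec.map (CommRingCat.ofHom (chartQuotientEquiv K lam c).toRingHom) ≫
        (subschemeChart (.vanishingIdeal (closedLocus K lam)) (chartAffineOpen K d c) ≫
        (Scheme.IdealSheafData.vanishingIdeal (closedLocus K lam)).subschemeι) ≫
          ProjSpace.toSpec K d := by
    rw [locusChart, coincidentRootLocus.toSpec]
    simp only [Category.assoc]
    rfl
  rw [h1, subschemeChart_ι _ _ (isAffineOpen_chartOpen K c), ← chartIso_hom_fromSpec,
    ProjSpace.toSpec]
  simp only [Category.assoc]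
  rw [Proj.awayι_toSpecZero_assoc]
  simp only [← Spec.map_comp]
  congr 1
  refine CommRingCat.hom_ext (RingHom.ext fun a => Subtype.ext ?_)
  have h2 := chartRestrict_chartIso K lam c
    (HomogeneousLocalization.fromZeroRingHom (coordGrading K d) _
      (algebraMap K (coordGrading K d 0) a))
  rw [chartAwayHom_fromZeroRingHom] at h2
  exact h2

/-- The charts `locusChart K lam c` cover `X_λ`. -/
theorem exists_mem_range_locusChart (x : coincidentRootLocus K lam) :
    ∃ c, x ∈ Set.range (locusChart K lam c) := by
  let y : ProjSpace K d := (Scheme.IdealSheafData.vanishingIdeal (closedLocus K lam)).subschemeι x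
  -- If every `evalForm K c d` vanished at `y`, so would all coordinates, and the ideal of `y` would
  -- contain the irrelevant ideal.
  obtain ⟨c, hc⟩ : ∃ c, y ∈ chartOpen K d c := by
    by_contra! h
    have hy : y.asHomogeneousIdeal.toIdeal.IsPrime := y.isPrime
    have : Infinite K := IsAlgClosed.instInfinite
    refine y.not_irrelevant_le (irrelevant_le_of_X_mem K _ (X_mem_of_evalForm_mem K fun c => ?_))
    have := h c
    rwa [Proj.mem_basicOpen, not_not] at this
  obtain ⟨z, hz⟩ := mem_range_subschemeChart _ (chartAffineOpen K d c) x hc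
  obtain ⟨w, hw⟩ := (Spec.map (CommRingCat.ofHom (chartQuotientEquiv K lam c).toRingHom)).surjective z
  exact ⟨c, w, (congrArg _ hw).trans hz⟩

/-- The open cover of `X_λ` by the charts `locusChart K lam c`. -/
def locusCover : (coincidentRootLocus K lam).AffineOpenCover where
  I₀ := K
  X _ := .of (coeffAlgebra K (Parts.size (lam := lam)))
  f c := locusChart K lam c
  idx x := (exists_mem_range_locusChart K lam x).choose
  covers x := (exists_mem_range_locusChart K lam x).choose_spec
  map_prop c := isOpenImmersion_locusChart K lam c

/-- The local rings of the source of an open immersion `Spec R ⟶ X` as local rings of `X`. -/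
def stalkEquivLocalization {X : Scheme.{u}} {R : CommRingCat.{u}} (f : Spec R ⟶ X)
    [IsOpenImmersion f] (q : PrimeSpectrum R) :
    X.presheaf.stalk (f q) ≃+* Localization.AtPrime q.asIdeal :=
  have : ∀ x : Spec R, IsIso (f.stalkMap x) := fun _ => inferInstance
  (@asIso _ _ _ _ (f.stalkMap q) (this q)).commRingCatIsoToRingEquiv.trans
    (IsLocalization.algEquiv q.asIdeal.primeCompl
      ((Spec.structureSheaf R).presheaf.stalk q) (Localization.AtPrime q.asIdeal)).toRingEquiv

/-- The local rings of `X_λ` are the local rings of the coefficient algebra. -/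
def locusStalkEquiv (q : PrimeSpectrum (coeffAlgebra K (Parts.size (lam := lam)))) :
    (coincidentRootLocus K lam).presheaf.stalk (locusChart K lam c q) ≃+*
      Localization.AtPrime q.asIdeal :=
  stalkEquivLocalization (locusChart K lam c) q

theorem locusChart_mem_singularLocus_iff
    (q : PrimeSpectrum (coeffAlgebra K (Parts.size (lam := lam)))) :
    locusChart K lam c q ∈ singularLocus (coincidentRootLocus K lam) ↔
      ¬ IsRegularLocalRing (Localization.AtPrime q.asIdeal) := by
  refine not_congr ⟨fun h => ?_, fun h => ?_⟩
  · exact IsRegularLocalRing.of_ringEquiv (locusStalkEquiv K lam c q)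
  · exact IsRegularLocalRing.of_ringEquiv
      (R := Localization.AtPrime q.asIdeal) (locusStalkEquiv K lam c q).symm

/-! ### Smoothness, and the codimension of the singular locus. -/

/-- `X_λ` is smooth if all parts of `λ` are equal. -/
theorem smooth_toSpec [CharZero K] {r : ℕ} (hr : 0 < r) (h : ∀ l : Parts lam, l.size = r) :
    Smooth (coincidentRootLocus.toSpec K lam) := by
  have : IsZariskiLocalAtSource (@Smooth.{u}) :=
    HasRingHomProperty.instIsZariskiLocalAtSource
  suffices h1 : ∀ c : K, Smooth (locusChart K lam c ≫ coincidentRootLocus.toSpec K lam) from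
    (IsZariskiLocalAtSource.iff_of_openCover (P := @Smooth) (locusCover K lam).openCover).2 h1
  intro c
  rw [locusChart_toSpec, HasRingHomProperty.Spec_iff (P := @Smooth), CommRingCat.hom_ofHom,
    RingHom.smooth_algebraMap]
  have : Algebra.Smooth K (MvPolynomial (Fin (Fintype.card (Parts lam))) K) :=
    ⟨inferInstance, inferInstance⟩
  exact Algebra.Smooth.of_equiv (coeffAlgebraEquiv K hr h)

theorem singularLocus_eq_empty [CharZero K] {r : ℕ} (hr : 0 < r) (h : ∀ l : Parts lam, l.size = r) :
    singularLocus (coincidentRootLocus K lam) = ∅ := by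
  refine Set.eq_empty_of_forall_notMem fun x hx => ?_
  obtain ⟨c, q, rfl⟩ := exists_mem_range_locusChart K lam x
  have : IsRegularRing (coeffAlgebra K (Parts.size (lam := lam))) :=
    IsRegularRing.of_ringEquiv (coeffAlgebraEquiv K hr h).toRingEquiv
  exact (locusChart_mem_singularLocus_iff K lam c q).1 hx
    (@IsRegularRing.isRegularLocalRing_localization _ _ this q.asIdeal (PrimeSpectrum.isPrime q))

theorem one_le_ringKrullDim_of_not_isRegularLocalRing {R : Type*} [CommRing R] [IsLocalRing R]
    [IsDomain R] (h : ¬ IsRegularLocalRing R) : 1 ≤ ringKrullDim R := by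
  by_contra hlt
  have h0 : Ring.KrullDimLE 0 R := by
    rw [Ring.krullDimLE_iff]
    exact ENat.WithBot.lt_add_one_iff.1 (by simpa using hlt)
  have hf : IsField R := Ring.KrullDimLE.isField_of_isDomain
  let := hf.toField
  exact h inferInstance

/-- `Sing(X_λ)` has codimension one if `λ` has different parts. -/
theorem codim_singularLocus_eq_one [CharZero K] {i j : Parts lam} (h : i.size ≠ j.size) :
    codim (singularLocus (coincidentRootLocus K lam)) = 1 := by
  classical
  refine le_antisymm ?_ (le_iInf₂ fun x hx => ?_)
  · obtain ⟨q, hq, hq1, hqs⟩ := exists_height_eq_one_and_not_isRegularLocalRing K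
      (m := Parts.size (lam := lam)) (fun l => Nat.succ_pos _) h
    obtain ⟨y, rfl⟩ : ∃ y : PrimeSpectrum (coeffAlgebra K (Parts.size (lam := lam))),
      y.asIdeal = q := ⟨⟨q, hq⟩, rfl⟩
    -- All charts have the same ring, so the chart at `c = 0` already contains a singular point of
    -- codimension one.
    refine (iInf₂_le (locusChart K lam 0 y)
      ((locusChart_mem_singularLocus_iff K lam 0 y).2 hqs)).trans ?_
    rw [ringKrullDim_eq_of_ringEquiv (locusStalkEquiv K lam 0 y),
      IsLocalization.AtPrime.ringKrullDim_eq_height y.asIdeal (Localization.AtPrime y.asIdeal), hq1]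
    rfl
  · obtain ⟨c, q, rfl⟩ := exists_mem_range_locusChart K lam x
    rw [ringKrullDim_eq_of_ringEquiv (locusStalkEquiv K lam c q)]
    exact one_le_ringKrullDim_of_not_isRegularLocalRing
      ((locusChart_mem_singularLocus_iff K lam c q).1 hx)

end Charts

end CoincidentRoot

end

theorem mainTheorem6 (K : Type u) [Field K] [IsAlgClosed K] [CharZero K] (d : ℕ)
    (lam : d.Partition) :
    (AlgebraicGeometry.Smooth (CoincidentRoot.coincidentRootLocus.toSpec K lam) ∧
        CoincidentRoot.singularLocus (CoincidentRoot.coincidentRootLocus K lam) = ∅) ∨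
      CoincidentRoot.codim
        (CoincidentRoot.singularLocus (CoincidentRoot.coincidentRootLocus K lam)) = 1 := by
  by_cases h : ∀ i j : CoincidentRoot.Parts lam, i.size = j.size
  · obtain ⟨r, hr, hl⟩ : ∃ r, 0 < r ∧ ∀ l : CoincidentRoot.Parts lam, l.size = r := by
      rcases isEmpty_or_nonempty (CoincidentRoot.Parts lam) with _ | ⟨⟨i⟩⟩
      -- There are no parts exactly when `d = 0`; any positive `r` works.
      · exact ⟨1, one_pos, isEmptyElim⟩
      · exact ⟨i.size, Nat.succ_pos _, fun l => h l i⟩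
    exact Or.inl ⟨CoincidentRoot.smooth_toSpec K lam hr hl,
      CoincidentRoot.singularLocus_eq_empty K lam hr hl⟩
  · push Not at h
    obtain ⟨i, j, hij⟩ := h
    exact Or.inr (CoincidentRoot.codim_singularLocus_eq_one K lam hij)
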